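/- Let $t,r\ge 1$, $m=\min(t,r)$, $P>0$, let $\mathsf H_{sr}\in\mathbb C^{t\times r}$, $\mathsf H_{sg}\in\mathbb C^{t\times 1}$, $\mathsf H_{gr}\in\mathbb C^{1\times r}$ and $A\in\mathbb C$ be a realization of the channel coefficients and the scattering efficiency of a backscatter tag, and for a tag symbol $d\in\{-1,1\}$ put $\mathsf H_d=\mathsf H_{sr}+d\,A\,\mathsf H_{sg}\mathsf H_{gr}$. Assume $\mathsf H_d\neq 0$ for both $d$. Over $n$ channel uses the channel is $\mathbb Y=\mathbb X\mathsf H_d+\mathbb W$, where $\mathbb X\in\mathbb C^{n\times t}$ and $\mathbb W\in\mathbb C^{n\times r}$ has i.i.d. $\mathcal{CN}(0,1)$ entries. An $(n,M,\epsilon)$ code has $M$ codewords $\mathsf X$ with $\|\mathsf X\|_F^2\le nP$ and a decoder with maximal error probability at most $\epsilon$; encoder and decoder both know the channel matrix. Let $R(n,\epsilon|d)$ be the supremum of $\frac1n\log M$ over all $M\ge 1$ for which an $(n,M,\epsilon)$ code exists for $\mathsf H_d$, and, for a law of $d$, let $R(n,\epsilon)=\mathbb P[d=-1]R(n,\epsilon|d=-1)+\mathbb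 P[d=1]R(n,\epsilon|d=1)$. Fix $d$. Let $g_1\ge\dots\ge g_m$ be the $m$ largest eigenvalues of $\mathsf H_d^H\mathsf H_d$. There is exactly one $\lambda$ with $\sum_{j=1}^m[\lambda-1/g_j]^+=P$ (a term with $g_j=0$ is $0$); put $p_j=[\lambda-1/g_j]^+$. Consider the $m$ parallel eigen-channels $Y_{i,j}=\sqrt{g_j}X_{i,j}+Z_{i,j}$, $1\le i\le n$, $1\le j\le m$, with $Z_{i,j}$ i.i.d. $\mathcal{CN}(0,1)$, and write $P_{\mathbb Y|\mathbb X=\mathsf X}$ for the law of the output given $\mathsf X\in\mathbb C^{n\times m}$. Let $F_n$ be the set of all $\mathsf X\in\mathbb C^{n\times m}$ with $\frac1n\sum_{i=1}^n|X_{i,j}|^2=p_j$ for all $j$, and let $P_{\mathbb Y}$ be the law of an $n\times m$ array of independent entries, those of column $j$ being $\mathcal{CN}(0,1+g_jp_j)$. (a) For every $n\ge1$ the set $F_n$ is non-empty, and for every $\mathsf X\in F_n$ one has $P_{\mathbb Y|\mathbb X=\mathsf X}\ll P_{\mathbb Y}$, and the information density $\log\frac{dP_{\mathbb Y|\mathbb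 X=\mathsf X}}{dP_{\mathbb Y}}(\mathbb Y)$ has under $P_{\mathbb Y}$ the law of $$G_n=\sum_{i=1}^n\sum_{j=1}^m\Big(\log(1+g_jp_j)+1-\big|\sqrt{g_jp_j}\,Z_{i,j}-\sqrt{1+g_jp_j}\big|^2\Big)$$ and under $P_{\mathbb Y|\mathbb X=\mathsf X}$ the law of $$H_n=\sum_{i=1}^n\sum_{j=1}^m\Big(\log(1+g_jp_j)+1-\frac{|\sqrt{g_jp_j}\,Z_{i,j}-1|^2}{1+g_jp_j}\Big).$$ For $0<\tau<\epsilon<1$ let $\kappa_\tau$ be the infimum of $\mathbb E_{P_{\mathbb Y}}[\varphi]$ over all randomized tests $\varphi$ (measurable, with values in $[0,1]$) such that $\mathbb E_{P_{\mathbb Y|\mathbb X=\mathsf X}}[\varphi]\ge\tau$ for every $\mathsf X\in F_n$, and for $\mathsf X\in F_n$ let $\beta_{1-\epsilon+\tau}$ be the infimum of $\mathbb E_{P_{\mathbb Y}}[\varphi]$ over all randomized tests with $\mathbb E_{P_{\mathbb Y|\mathbb X=\mathsf X}}[\varphi]\ge1-\epsilon+\tau$. There is a constant $C_1>0$, which depends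 only on the channel realization and on $P$ (not on $d$, $n$, $\epsilon$, $\tau$ or the law of $d$), such that for all $n\ge 1$ and all $0<\tau<\epsilon<1$ the following holds. (b) For both $d$: there is a number $\gamma_n$ with $\mathbb P[H_n\ge\gamma_n]=1-\epsilon+\tau$, and for every such $\gamma_n$ and every $\mathsf X\in F_n$, $$\beta_{1-\epsilon+\tau}=\mathbb P[G_n\ge\gamma_n]>0,\qquad \kappa_\tau\ge\frac{\tau}{C_1},$$ $$R(n,\epsilon|d)\ge\frac1n\log\frac{\kappa_\tau}{\beta_{1-\epsilon+\tau}},\qquad R(n,\epsilon|d)\ge\frac1n\log\frac{\tau/C_1}{\beta_{1-\epsilon+\tau}}.$$ (c) For every law of $d$ on $\{-1,1\}$, with $\beta_{1-\epsilon+\tau}(d)$ the quantity in (b) for the symbol $d$, $$R(n,\epsilon)\ge\frac{\mathbb P[d=-1]}{n}\log\frac{\tau/C_1}{\beta_{1-\epsilon+\tau}(-1)}+\frac{\mathbb P[d=1]}{n}\log\frac{\tau/C_1}{\beta_{1-\epsilon+\tau}(1)}.$$ -/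

import Mathlib

open MeasureTheory ProbabilityTheory
open scoped NNReal ENNReal Matrix

noncomputable section

namespace AmBC

/-! ### Complex Gaussian laws -/

/-- The complex Gaussian law `CN(c, v)`: real and imaginary parts are independent real Gaussian
variables with means `c.re`, `c.im` and with variance `v / 2` each. -/
def complexGaussian (c : ℂ) (v : ℝ≥0) : Measure ℂ :=
  ((gaussianReal c.re (v / 2)).prod (gaussianReal c.im (v / 2))).map
    Complex.measurableEquivRealProd.symm

/-- The law of an `a × b` array of independent `CN(0, 1)` entries. -/
def stdNoise (a b : ℕ) : Measure (Fin a → Fin b → ℂ) :=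
  Measure.pi fun _ => Measure.pi fun _ => complexGaussian 0 1

/-! ### The backscatter channel and its codes -/

/-- The channel matrix seen by the receiver while the tag symbol is `d`, that is `H₀ + d H₁` with
`H₀ = Hsr` and `H₁ = A Hsg Hgr`. The units `ℤˣ` of `ℤ` are `1` and `-1`. -/
def effChannel {t r : ℕ} (Hsr : Matrix (Fin t) (Fin r) ℂ) (Hsg : Matrix (Fin t) (Fin 1) ℂ)
    (Hgr : Matrix (Fin 1) (Fin r) ℂ) (A : ℂ) (d : ℤˣ) : Matrix (Fin t) (Fin r) ℂ :=
  Hsr + ((d : ℤ) : ℂ) • (A • (Hsg * Hgr))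

/-- The law of the received array `Y = X H + W`, for the channel realization `H`. -/
def mimoLaw {n t r : ℕ} (H : Matrix (Fin t) (Fin r) ℂ) (X : Matrix (Fin n) (Fin t) ℂ) :
    Measure (Fin n → Fin r → ℂ) :=
  (stdNoise n r).map fun W i k => (X * H) i k + W i k

/-- An `(n, M, ε)` code with perfect channel state information at both ends. The encoder and the
decoder are told the channel matrix; the maximal error probability is the one over the noise when
the realization of the channel is `H`. -/
structure Code (n M t r : ℕ) (P ε : ℝ) (H : Matrix (Fin t) (Fin r) ℂ) where
  encoder : Fin M → Matrix (Fin t) (Fin r) ℂ → Matrix (Fin n) (Fin t) ℂ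
  power_le : ∀ j H', ∑ i, ∑ k, ‖encoder j H' i k‖ ^ 2 ≤ n * P
  decoder : (Fin n → Fin r → ℂ) → Matrix (Fin t) (Fin r) ℂ → Fin M
  measurable_decoder : ∀ H', Measurable fun Y => decoder Y H'
  error_le : ∀ j, (mimoLaw H (encoder j H)).real {Y | decoder Y H ≠ j} ≤ ε

/-- The maximal rate of a code of blocklength `n`, power `P` and error probability `ε` over the
channel realization `H`, as a supremum in the extended reals. -/
def maxRate (n : ℕ) {t r : ℕ} (P ε : ℝ) (H : Matrix (Fin t) (Fin r) ℂ) : EReal :=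
  ⨆ (M : ℕ) (_ : 1 ≤ M) (_ : Nonempty (Code n M t r P ε H)), ((Real.log M / n : ℝ) : EReal)

/-- The maximal rate averaged over the law of the tag symbol. -/
def avgRate (n : ℕ) {t r : ℕ} (P ε : ℝ) (H : ℤˣ → Matrix (Fin t) (Fin r) ℂ) (tag : PMF ℤˣ) :
    EReal :=
  (((tag (-1)).toReal : ℝ) : EReal) * maxRate n P ε (H (-1)) +
    (((tag 1).toReal : ℝ) : EReal) * maxRate n P ε (H 1)

/-! ### Eigen-channels and water-filling -/

/-- The `min t r` largest eigenvalues of `Hᴴ H`, in decreasing order. -/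
def gains {t r : ℕ} (H : Matrix (Fin t) (Fin r) ℂ) (j : Fin (min t r)) : ℝ :=
  (Matrix.isHermitian_conjTranspose_mul_self H).eigenvalues₀
    ⟨j, by rw [Fintype.card_fin]; exact lt_of_lt_of_le j.2 (min_le_right t r)⟩

/-- The power `[l - 1 / g]⁺` that water level `l` puts on an eigen-channel of gain `g`; it is `0`
on a channel of gain `0`, where `1 / g` means `∞`. -/
def waterPower (l g : ℝ) : ℝ := if g = 0 then 0 else max (l - 1 / g) 0

/-- `l` is a water level for total power `P`. -/
def IsWaterLevel {m : ℕ} (g : Fin m → ℝ) (P l : ℝ) : Prop := ∑ j, waterPower l (g j) = P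

/-- The water-filling power vector. -/
def waterFill {m : ℕ} (g : Fin m → ℝ) (l : ℝ) (j : Fin m) : ℝ := waterPower l (g j)

/-- The power `p_j(X) = ‖X_j‖² / n` that `X` spends on the eigen-channel `j`. -/
def power {n m : ℕ} (X : Matrix (Fin n) (Fin m) ℂ) (j : Fin m) : ℝ :=
  (1 / n : ℝ) * ∑ i, ‖X i j‖ ^ 2

/-- The inputs of the eigen-channels whose power vector is `p`. -/
def inputSet (n : ℕ) {m : ℕ} (p : Fin m → ℝ) : Set (Matrix (Fin n) (Fin m) ℂ) :=
  {X | ∀ j, power X j = p j}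

/-- The law of the output of the parallel Gaussian eigen-channels
`Y i j = √(g j) X i j + Z i j`, given the input `X`. -/
def eigenLaw {n m : ℕ} (g : Fin m → ℝ) (X : Matrix (Fin n) (Fin m) ℂ) :
    Measure (Fin n → Fin m → ℂ) :=
  (stdNoise n m).map fun Z i j => (Real.sqrt (g j) : ℂ) * X i j + Z i j

/-- The auxiliary output law: independent entries, `CN(0, 1 + g j p j)` in column `j`. -/
def auxLaw (n : ℕ) {m : ℕ} (p g : Fin m → ℝ) : Measure (Fin n → Fin m → ℂ) :=
  Measure.pi fun _ => Measure.pi fun j => complexGaussian 0 (1 + g j * p j).toNNReal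

/-- The information density `log (dP_{Y|X=X} / dP_Y)`. -/
def infoDensity {n m : ℕ} (p g : Fin m → ℝ) (X : Matrix (Fin n) (Fin m) ℂ) :
    (Fin n → Fin m → ℂ) → ℝ :=
  llr (eigenLaw g X) (auxLaw n p g)

/-- The variable `G_n(p, g)`, as a function of the array `Z`. -/
def Gn {n m : ℕ} (p g : Fin m → ℝ) (Z : Fin n → Fin m → ℂ) : ℝ :=
  ∑ i, ∑ j, (Real.log (1 + g j * p j) + 1 -
    ‖(Real.sqrt (g j * p j) : ℂ) * Z i j - (Real.sqrt (1 + g j * p j) : ℂ)‖ ^ 2)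

/-- The variable `H_n(p, g)`, as a function of the array `Z`. -/
def Hn {n m : ℕ} (p g : Fin m → ℝ) (Z : Fin n → Fin m → ℂ) : ℝ :=
  ∑ i, ∑ j, (Real.log (1 + g j * p j) + 1 -
    ‖(Real.sqrt (g j * p j) : ℂ) * Z i j - 1‖ ^ 2 / (1 + g j * p j))

/-- `ℙ[G_n ≥ γ]` for independent `CN(0, 1)` variables `Z i j`. -/
def probG (n : ℕ) {m : ℕ} (p g : Fin m → ℝ) (γ : ℝ) : ℝ :=
  (stdNoise n m).real {Z | γ ≤ Gn p g Z}

/-- `ℙ[H_n ≥ γ]` for independent `CN(0, 1)` variables `Z i j`. -/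
def probH (n : ℕ) {m : ℕ} (p g : Fin m → ℝ) (γ : ℝ) : ℝ :=
  (stdNoise n m).real {Z | γ ≤ Hn p g Z}

/-! ### Binary hypothesis testing -/

/-- A randomized test: `φ y` is the probability of accepting upon observing `y`. -/
def IsTest {α : Type*} [MeasurableSpace α] (φ : α → ℝ) : Prop :=
  Measurable φ ∧ ∀ y, 0 ≤ φ y ∧ φ y ≤ 1

/-- `β_a(μ, ν)`: the least `ν`-probability of acceptance of a test that accepts with
`μ`-probability at least `a`. -/
def beta {α : Type*} [MeasurableSpace α] (a : ℝ) (μ ν : Measure α) : ℝ :=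
  sInf {b | ∃ φ : α → ℝ, IsTest φ ∧ a ≤ ∫ y, φ y ∂μ ∧ b = ∫ y, φ y ∂ν}

/-- `κ_τ(F, ν)`: the least `ν`-probability of acceptance of a test that accepts with probability
at least `τ` under the law `K x` of the output, for every input `x ∈ F`. -/
def kappa {ι α : Type*} [MeasurableSpace α] (τ : ℝ) (F : Set ι) (K : ι → Measure α)
    (ν : Measure α) : ℝ :=
  sInf {b | ∃ φ : α → ℝ, IsTest φ ∧ (∀ x ∈ F, τ ≤ ∫ y, φ y ∂(K x)) ∧ b = ∫ y, φ y ∂ν}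

end AmBC

end

/-!
Let `ν` be the auxiliary output law, with independent entries `CN(0, 1 + g j p j)` in column `j`.
Every input `X` in the set `F` of inputs of power vector `p` sees the same testing problem against
`ν`, and `F` is hard to cover by a test of small `ν`-probability; a greedy choice of codewords turns
these two facts into a code.

*The information density.* The output law of the eigen-channels has an explicit density with respect
to `ν` (`eigenLaw_eq_withDensity`). On `F` its logarithm is, column by column, an affine function
of the squared norm of the noise and of the inner product of the noise with the input. The noise is
invariant under reflections of its columns, and a reflection moves every input in `F` to every
other one, so the law of the information density does not depend on `X ∈ F`
(`map_quadStat_congr`); for the constant input it is the law of `Gn` or `Hn`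
(`map_infoDensity_auxLaw`, `map_infoDensity_eigenLaw`). The law of `Hn` has no atoms, because a
circle is a null set of the plane, so a threshold of the exact level exists (`exists_probH_eq`), and
by the Neyman-Pearson lemma `β` is the tail probability of `Gn` (`beta_eq_probG`).

*The bound on `κ`.* A test that accepts with probability at least `τ` for every `X ∈ F` does so for
a random `X`. Let the columns of `X` be independent and uniform on their spheres, symmetrized under
`x ↦ -x`. Then the output law is at most a constant, independent of `n`, times `ν`
(`exists_sphere_mixture`). Indeed, both laws are mixtures over directions `u`: for a fixed direction
and radius `x` the symmetrized output density is `exp(-g x²) cosh(x c)` with `c` a linear function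
of the output; `ν` averages it over the radial law of a Gaussian vector, while the sphere has
`x² = n p`. Comparing the power series in `c` term by term, the ratio of the coefficients is that of
a Poisson weight of mean `n g p` to the negative binomial weight of the same mean. The negative
binomial law is the wider one by a bounded factor, and Stirling's formula bounds the ratio by
`2 e √(1 + g p)` (`poisson_le_negBinomial`, `cosh_le_lintegral_radial`). The product over the
columns is the constant `kappaConst`, and `div_le_kappa` follows.

*Codes.* Add codewords of `F` as long as the part of `{information density ≥ γ}` not yet used by
earlier codewords has probability at least `1 - ε`. When this stops, the union of the decoding sets
has probability at least `τ` under every `X ∈ F`, hence `ν`-probability at least `κ`, whereas every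
decoding set has `ν`-probability at most `β`. So there are at least `κ / β` codewords
(`exists_code`).

*Reduction.* With the right singular vectors `V` of `H` and its left singular vectors `U`, sending
`X Uᴴ` and observing `Y V` gives exactly the eigen-channels (`map_rightMul_mimoLaw`), at no greater
power, so that their codes are codes for `H`. The water level exists and is unique because the total
power is a continuous function of it that increases strictly where it is positive
(`existsUnique_isWaterLevel`).
-/

open MeasureTheory ProbabilityTheory
open scoped NNReal ENNReal Matrix

noncomputable section

namespace AmBC

/-! ### Finite product measures -/

theorem lintegral_pi_prod {ι : Type*} [Fintype ι] {α : ι → Type*} [∀ i, MeasurableSpace (α i)]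
    (μ : ∀ i, Measure (α i)) [∀ i, IsProbabilityMeasure (μ i)] {f : ∀ i, α i → ℝ≥0∞}
    (hf : ∀ i, Measurable (f i)) :
    ∫⁻ x, ∏ i, f i (x i) ∂Measure.pi μ = ∏ i, ∫⁻ x, f i x ∂μ i := by
  have hind : iIndepFun (fun i (x : ∀ i, α i) => f i (x i)) (Measure.pi μ) :=
    iIndepFun_pi (fun i => (hf i).aemeasurable)
  have h := lintegral_prod_eq_prod_lintegral_of_indepFun Finset.univ
    (fun i (x : ∀ i, α i) => f i (x i)) hind (fun i => (hf i).comp (measurable_pi_apply i))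
  rw [h]
  refine Finset.prod_congr rfl fun i _ => ?_
  rw [← (measurePreserving_eval μ i).lintegral_comp (hf i)]

theorem pi_withDensity {ι : Type*} [Fintype ι] {α : ι → Type*} [∀ i, MeasurableSpace (α i)]
    (μ : ∀ i, Measure (α i)) [∀ i, IsProbabilityMeasure (μ i)] {f : ∀ i, α i → ℝ≥0∞}
    (hf : ∀ i, Measurable (f i)) [∀ i, SigmaFinite ((μ i).withDensity (f i))] :
    Measure.pi (fun i => (μ i).withDensity (f i)) =
      (Measure.pi μ).withDensity fun x => ∏ i, f i (x i) := by
  refine Measure.pi_eq fun s hs => ?_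
  rw [withDensity_apply _ (MeasurableSet.univ_pi hs), ← lintegral_indicator (.univ_pi hs)]
  have : ∀ x : (∀ i, α i), (Set.univ.pi s).indicator (fun x => ∏ i, f i (x i)) x =
      ∏ i, (s i).indicator (f i) (x i) := by
    intro x
    by_cases hx : x ∈ Set.univ.pi s
    · rw [Set.indicator_of_mem hx]
      exact Finset.prod_congr rfl fun i _ => (Set.indicator_of_mem (hx i trivial) _).symm
    · rw [Set.indicator_of_notMem hx]
      obtain ⟨i, hi⟩ : ∃ i, x i ∉ s i := by
        by_contra! hc; exact hx fun i _ => hc i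
      exact (Finset.prod_eq_zero (Finset.mem_univ i) (Set.indicator_of_notMem hi _)).symm
  simp_rw [this]
  rw [lintegral_pi_prod μ fun i => (hf i).indicator (hs i)]
  refine Finset.prod_congr rfl fun i _ => ?_
  rw [lintegral_indicator (hs i), withDensity_apply _ (hs i)]

/-- A measure that is at most the product measure on boxes is at most the product measure. -/
theorem le_pi_of_forall_rect {ι : Type*} [Fintype ι] {α : ι → Type*} [∀ i, MeasurableSpace (α i)]
    (ν : ∀ i, Measure (α i)) (m : Measure (∀ i, α i))
    (h : ∀ s : ∀ i, Set (α i), m (Set.univ.pi s) ≤ ∏ i, ν i (s i)) : m ≤ Measure.pi ν := by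
  have h' : m.toOuterMeasure ≤ OuterMeasure.pi fun i => (ν i).toOuterMeasure := by
    rw [OuterMeasure.le_pi]
    intro s _
    exact h s
  refine Measure.le_iff.2 fun s hs => ?_
  rw [Measure.pi_def, toMeasure_apply _ _ hs]
  exact h' s

theorem pi_le_smul_pi {ι : Type*} [Fintype ι] {α : ι → Type*} [∀ i, MeasurableSpace (α i)]
    (μ ν : ∀ i, Measure (α i)) [∀ i, IsProbabilityMeasure (μ i)] (C : ι → ℝ≥0∞)
    (hC0 : ∀ i, C i ≠ 0) (hC : ∀ i, C i ≠ ∞)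
    (h : ∀ i, μ i ≤ C i • ν i) : Measure.pi μ ≤ (∏ i, C i) • Measure.pi ν := by
  have hP0 : ∏ i, C i ≠ 0 := Finset.prod_ne_zero_iff.2 fun i _ => hC0 i
  have hP : ∏ i, C i ≠ ∞ := ENNReal.prod_ne_top fun i _ => hC i
  have key : (∏ i, C i)⁻¹ • Measure.pi μ ≤ Measure.pi ν := by
    refine le_pi_of_forall_rect _ _ fun s => ?_
    rw [Measure.smul_apply, smul_eq_mul, Measure.pi_pi, ENNReal.inv_mul_le_iff hP0 hP,
      ← Finset.prod_mul_distrib]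
    exact Finset.prod_le_prod' fun i _ => by simpa using h i (s i)
  refine Measure.le_iff.2 fun s _ => ?_
  have := key s
  rw [Measure.smul_apply, smul_eq_mul, ENNReal.inv_mul_le_iff hP0 hP] at this
  simpa using this

/-- A sum of independent variables one of which has no atoms has no atoms. -/
theorem pi_sum_eq_null {n : ℕ} {α : Type*} [MeasurableSpace α] (μ : Fin n → Measure α)
    [∀ i, IsProbabilityMeasure (μ i)] (f : Fin n → α → ℝ) (hf : ∀ i, Measurable (f i))
    (i₀ : Fin n) (h : ∀ c, μ i₀ {x | f i₀ x = c} = 0) (c : ℝ) :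
    Measure.pi μ {x | ∑ i, f i (x i) = c} = 0 := by
  obtain ⟨k, rfl⟩ : ∃ k, n = k + 1 := ⟨n - 1, by have := i₀.pos; omega⟩
  have hmp := measurePreserving_piFinSuccAbove (α := fun _ => α) μ i₀
  have hS : MeasurableSet {y : α × (Fin k → α) |
      f i₀ y.1 + ∑ j, f (i₀.succAbove j) (y.2 j) = c} := by
    refine measurableSet_eq_fun ?_ measurable_const
    exact ((hf _).comp measurable_fst).add (Finset.measurable_sum _ fun j _ =>
      (hf _).comp ((measurable_pi_apply j).comp measurable_snd))
  have : {x : Fin (k + 1) → α | ∑ i, f i (x i) = c} =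
      MeasurableEquiv.piFinSuccAbove (fun _ => α) i₀ ⁻¹' {y : α × (Fin k → α) |
      f i₀ y.1 + ∑ j, f (i₀.succAbove j) (y.2 j) = c} := by
    ext x
    simp [Fin.sum_univ_succAbove _ i₀, Fin.removeNth]
  rw [this, hmp.measure_preimage hS.nullMeasurableSet, Measure.prod_apply_symm hS]
  refine lintegral_eq_zero_of_ae_eq_zero (Filter.Eventually.of_forall fun y => ?_)
  rw [Pi.zero_apply, ← h (c - ∑ j, f (i₀.succAbove j) (y j))]
  refine congrArg _ (Set.ext fun x => ?_)
  simp [eq_sub_iff_add_eq]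

/-- The distribution of a variable without atoms takes every value strictly between `0` and `1`. -/
theorem exists_real_tail_eq {α : Type*} [MeasurableSpace α] (μ : Measure α)
    [IsProbabilityMeasure μ] {f : α → ℝ} (hf : Measurable f) (h : ∀ c, μ {x | f x = c} = 0)
    {a : ℝ} (h0 : 0 < a) (h1 : a < 1) : ∃ γ : ℝ, μ.real {x | γ ≤ f x} = a := by
  have hprob : IsProbabilityMeasure (μ.map f) := Measure.isProbabilityMeasure_map hf.aemeasurable
  have hsing : ∀ c, μ.map f {c} = 0 := fun c => by
    rw [Measure.map_apply hf (measurableSet_singleton c)]; exact h c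
  have hcont : Continuous (cdf (μ.map f)) := by
    refine continuous_iff_continuousAt.2 fun x => ?_
    rw [(monotone_cdf (μ.map f)).continuousAt_iff_leftLim_eq_rightLim,
      StieltjesFunction.rightLim_eq]
    have h0 := StieltjesFunction.measure_singleton (cdf (μ.map f)) x
    rw [measure_cdf, hsing x, eq_comm, ENNReal.ofReal_eq_zero] at h0
    exact le_antisymm ((monotone_cdf (μ.map f)).leftLim_le le_rfl) (by linarith)
  have htail : ∀ γ, μ.real {x | γ ≤ f x} = 1 - cdf (μ.map f) γ := by
    intro γ
    have e1 : μ.real {x | γ ≤ f x} = (μ.map f).real (Set.Ici γ) := by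
      rw [map_measureReal_apply hf measurableSet_Ici]; rfl
    have e2 : (μ.map f).real (Set.Ici γ) = (μ.map f).real (Set.Ioi γ) := by
      refine measureReal_congr ?_
      have : NullSingletonClass (μ.map f) := ⟨hsing⟩
      exact Ioi_ae_eq_Ici.symm
    rw [e1, e2, cdf_eq_real, ← probReal_compl_eq_one_sub measurableSet_Iic, Set.compl_Iic]
  obtain ⟨γ, hγ⟩ : ∃ γ, cdf (μ.map f) γ = 1 - a := by
    have := mem_range_of_exists_le_of_exists_ge hcont (c := 1 - a)
      (((tendsto_cdf_atBot (μ.map f)).eventually_le_const (by linarith)).exists)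
      (((tendsto_cdf_atTop (μ.map f)).eventually_const_le (by linarith)).exists)
    exact this
  exact ⟨γ, by rw [htail, hγ]; ring⟩

/-! ### Binary hypothesis tests -/

section Tests

variable {α : Type*} [MeasurableSpace α]

theorem IsTest.integrable {φ : α → ℝ} (hφ : IsTest φ) (μ : Measure α) [IsFiniteMeasure μ] :
    Integrable φ μ :=
  Integrable.of_bound hφ.1.aestronglyMeasurable 1 (Filter.Eventually.of_forall fun y => by
    rw [Real.norm_eq_abs, abs_of_nonneg (hφ.2 y).1]; exact (hφ.2 y).2)

theorem isTest_indicator {s : Set α} (hs : MeasurableSet s) : IsTest (s.indicator (1 : α → ℝ)) := by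
  refine ⟨measurable_one.indicator hs, fun y => ?_⟩
  by_cases hy : y ∈ s <;> simp [hy]

/-- The Neyman-Pearson lemma. -/
theorem beta_eq_of_llr (μ ν : Measure α) [IsProbabilityMeasure μ] [IsProbabilityMeasure ν]
    (hμν : μ ≪ ν) (hνμ : ν ≪ μ) {a γ : ℝ} (hγ : μ.real {y | γ ≤ llr μ ν y} = a) :
    beta a μ ν = ν.real {y | γ ≤ llr μ ν y} := by
  have hmeas : MeasurableSet {y | γ ≤ llr μ ν y} :=
    measurableSet_le measurable_const (measurable_llr μ ν)
  set S := {y | γ ≤ llr μ ν y} with hS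
  have hlow : ∀ φ : α → ℝ, IsTest φ → a ≤ ∫ y, φ y ∂μ → ν.real S ≤ ∫ y, φ y ∂ν := by
    intro φ hφ ha
    have hT := isTest_indicator hmeas
    set ψ : α → ℝ := fun y => S.indicator 1 y - φ y with hψ
    have hψμ : Integrable ψ μ := (hT.integrable μ).sub (hφ.integrable μ)
    have hψν : Integrable ψ ν := (hT.integrable ν).sub (hφ.integrable ν)
    have hle : ∫ y, ψ y ∂μ ≤ 0 := by
      rw [integral_sub (hT.integrable μ) (hφ.integrable μ), integral_indicator_one hmeas, hγ]
      linarith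
    have hrn : ∫ y, (μ.rnDeriv ν y).toReal * ψ y ∂ν = ∫ y, ψ y ∂μ := by
      simpa [smul_eq_mul] using integral_rnDeriv_smul (f := ψ) hμν
    have hrni : Integrable (fun y => (μ.rnDeriv ν y).toReal * ψ y) ν := by
      simpa [smul_eq_mul] using (integrable_rnDeriv_smul_iff (f := ψ) hμν).2 hψμ
    -- `ψ` and `dμ/dν - e^γ` have the same sign
    have hge : Real.exp γ * ∫ y, ψ y ∂ν ≤ ∫ y, (μ.rnDeriv ν y).toReal * ψ y ∂ν := by
      rw [← integral_const_mul]
      refine integral_mono_ae (hψν.const_mul _) hrni ?_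
      filter_upwards [exp_llr_of_ac' μ ν hνμ] with y hy
      rw [← hy]
      by_cases hyS : y ∈ S
      · refine mul_le_mul_of_nonneg_right (Real.exp_le_exp.2 hyS) ?_
        simp [hψ, hyS, (hφ.2 y).2]
      · refine mul_le_mul_of_nonpos_right (Real.exp_le_exp.2 (not_le.1 hyS).le) ?_
        simp [hψ, hyS, (hφ.2 y).1]
    have : ∫ y, ψ y ∂ν ≤ 0 := by
      by_contra! hc
      have := mul_pos (Real.exp_pos γ) hc
      linarith
    rw [integral_sub (hT.integrable ν) (hφ.integrable ν), integral_indicator_one hmeas] at this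
    linarith
  refine IsLeast.csInf_eq ⟨⟨S.indicator 1, isTest_indicator hmeas, ?_, ?_⟩, ?_⟩
  · rw [integral_indicator_one hmeas, hγ]
  · rw [integral_indicator_one hmeas]
  · rintro b ⟨φ, hφ, ha, rfl⟩
    exact hlow φ hφ ha

end Tests

/-! ### Complex Gaussian laws -/

instance (c : ℂ) (v : ℝ≥0) : IsProbabilityMeasure (complexGaussian c v) :=
  Measure.isProbabilityMeasure_map (MeasurableEquiv.measurable _).aemeasurable

instance (a b : ℕ) : IsProbabilityMeasure (stdNoise a b) := by
  unfold stdNoise; infer_instance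

theorem charFunDual_gaussianReal (m : ℝ) (v : ℝ≥0) (K : StrongDual ℝ ℝ) :
    charFunDual (gaussianReal m v) K =
      Complex.exp (K 1 * m * Complex.I - v * (K 1 : ℂ) ^ 2 / 2) := by
  rw [← charFun_gaussianReal, charFunDual_apply, charFun_apply_real]
  congr with x
  have : K x = K 1 * x := by
    rw [mul_comm, ← smul_eq_mul, ← map_smul, smul_eq_mul, mul_one]
  rw [this]; push_cast; ring_nf

theorem charFunDual_complexGaussian (c : ℂ) (v : ℝ≥0) (K : StrongDual ℝ ℂ) :
    charFunDual (complexGaussian c v) K =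
      Complex.exp (K c * Complex.I - v / 4 * ((K 1 : ℂ) ^ 2 + (K Complex.I : ℂ) ^ 2)) := by
  have h1 : complexGaussian c v = ((gaussianReal c.re (v / 2)).prod
      (gaussianReal c.im (v / 2))).map Complex.equivRealProdCLM.symm := rfl
  rw [h1]
  have h2 := charFunDual_map (μ := (gaussianReal c.re (v / 2)).prod (gaussianReal c.im (v / 2)))
    (Complex.equivRealProdCLM.symm : ℝ × ℝ →L[ℝ] ℂ) K
  rw [ContinuousLinearEquiv.coe_coe] at h2
  rw [h2, charFunDual_prod, charFunDual_gaussianReal, charFunDual_gaussianReal, ← Complex.exp_add]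
  have e1 : Complex.equivRealProdCLM.symm (1, 0) = 1 := by
    rw [ContinuousLinearEquiv.symm_apply_eq]; simp
  have e2 : Complex.equivRealProdCLM.symm (0, 1) = Complex.I := by
    rw [ContinuousLinearEquiv.symm_apply_eq]; simp
  have e3 : K c = c.re * K 1 + c.im * K Complex.I := by
    conv_lhs => rw [← Complex.re_add_im c]
    rw [map_add, mul_comm (c.im : ℂ), show (c.re : ℂ) = c.re • (1 : ℂ) by simp,
      show Complex.I * (c.im : ℂ) = c.im • Complex.I by simp [mul_comm], map_smul, map_smul]
    simp
  simp only [ContinuousLinearMap.comp_apply, ContinuousLinearMap.inl_apply,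
    ContinuousLinearMap.inr_apply, ContinuousLinearEquiv.coe_coe, e1, e2, e3]
  congr 1
  push_cast
  ring

theorem map_const_add_complexGaussian (c : ℂ) (v : ℝ≥0) :
    (complexGaussian 0 v).map (c + ·) = complexGaussian c v := by
  have := Measure.isProbabilityMeasure_map (μ := complexGaussian 0 v) (f := (c + ·))
    (by fun_prop)
  refine Measure.ext_of_charFunDual (funext fun K => ?_)
  rw [charFunDual_map_const_add, charFunDual_complexGaussian, charFunDual_complexGaussian,
    ← Complex.exp_add]
  congr 1
  simp
  ring

theorem map_mul_complexGaussian (a : ℝ) (v : ℝ≥0) :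
    (complexGaussian 0 v).map ((a : ℂ) * ·) = complexGaussian 0 ((a ^ 2).toNNReal * v) := by
  have := Measure.isProbabilityMeasure_map (μ := complexGaussian 0 v) (f := ((a : ℂ) * ·))
    (by fun_prop)
  refine Measure.ext_of_charFunDual (funext fun K => ?_)
  have h : ((a : ℂ) * ·) = ⇑(a • ContinuousLinearMap.id ℝ ℂ) := by ext; simp
  rw [h, charFunDual_map, charFunDual_complexGaussian, charFunDual_complexGaussian]
  congr 1
  have : (((a ^ 2).toNNReal : ℝ) : ℂ) = (a : ℂ) ^ 2 := by
    rw [Real.coe_toNNReal _ (sq_nonneg a)]; push_cast; rfl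
  simp only [ContinuousLinearMap.comp_apply, _root_.smul_apply,
    ContinuousLinearMap.id_apply, map_smul, smul_eq_mul, map_zero, Complex.ofReal_mul,
    NNReal.coe_mul, this]
  ring

/-- The density of `CN(c, v)` with respect to the Lebesgue measure of the plane. -/
def complexGaussianPDF (c : ℂ) (v : ℝ) (z : ℂ) : ℝ :=
  (Real.pi * v)⁻¹ * Real.exp (-(‖z - c‖ ^ 2 / v))

theorem complexGaussianPDF_pos (c : ℂ) {v : ℝ} (hv : 0 < v) (z : ℂ) :
    0 < complexGaussianPDF c v z := by
  unfold complexGaussianPDF; positivity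

theorem measurable_complexGaussianPDF (c : ℂ) (v : ℝ) : Measurable (complexGaussianPDF c v) := by
  unfold complexGaussianPDF; fun_prop

theorem complexGaussian_eq_withDensity (c : ℂ) {v : ℝ≥0} (hv : v ≠ 0) :
    complexGaussian c v =
      volume.withDensity fun z => ENNReal.ofReal (complexGaussianPDF c v z) := by
  have hv2 : v / 2 ≠ 0 := by simpa using hv
  have hvp : (0 : ℝ) < v := by positivity
  refine Measure.ext fun s hs => ?_
  rw [withDensity_apply _ hs, complexGaussian, MeasurableEquiv.map_apply,
    gaussianReal_of_var_ne_zero _ hv2, gaussianReal_of_var_ne_zero _ hv2,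
    prod_withDensity (measurable_gaussianPDF _ _) (measurable_gaussianPDF _ _),
    withDensity_apply _ ((MeasurableEquiv.measurable _) hs),
    ← (Complex.volume_preserving_equiv_real_prod.symm).setLIntegral_comp_preimage hs
      ((measurable_complexGaussianPDF c v).ennreal_ofReal)]
  refine lintegral_congr fun y => ?_
  rw [gaussianPDF, gaussianPDF, ← ENNReal.ofReal_mul (gaussianPDFReal_nonneg _ _ _)]
  congr 1
  have hn : ‖Complex.measurableEquivRealProd.symm y - c‖ ^ 2 =
      (y.1 - c.re) ^ 2 + (y.2 - c.im) ^ 2 := by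
    rw [Complex.sq_norm, Complex.normSq_apply]
    simp [Complex.measurableEquivRealProd]
    ring
  have hs2 : (√(2 * Real.pi * (v / 2)))⁻¹ * (√(2 * Real.pi * (v / 2)))⁻¹ = (Real.pi * v)⁻¹ := by
    rw [← mul_inv, Real.mul_self_sqrt (by positivity)]
    congr 1; ring
  rw [gaussianPDFReal, gaussianPDFReal, complexGaussianPDF, hn, NNReal.coe_div, NNReal.coe_ofNat,
    mul_mul_mul_comm, hs2, ← Real.exp_add]
  congr 2
  field_simp
  ring

/-- Change of measure between two nondegenerate complex Gaussian laws. -/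
theorem complexGaussian_eq_withDensity_complexGaussian (c c' : ℂ) {v v' : ℝ≥0} (hv : v ≠ 0)
    (hv' : v' ≠ 0) :
    complexGaussian c v = (complexGaussian c' v').withDensity fun z =>
      ENNReal.ofReal (v' / v * Real.exp (‖z - c'‖ ^ 2 / v' - ‖z - c‖ ^ 2 / v)) := by
  have hvp : (0 : ℝ) < v := by positivity
  have hvp' : (0 : ℝ) < v' := by positivity
  rw [complexGaussian_eq_withDensity c hv, complexGaussian_eq_withDensity c' hv',
    ← withDensity_mul _ (measurable_complexGaussianPDF c' v').ennreal_ofReal (by fun_prop)]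
  congr with z
  rw [Pi.mul_apply, ← ENNReal.ofReal_mul (complexGaussianPDF_pos _ hvp' _).le]
  congr 1
  rw [complexGaussianPDF, complexGaussianPDF, Real.exp_sub, Real.exp_neg, Real.exp_neg]
  field_simp

theorem pi_complexGaussian_eq_withDensity {ι : Type*} [Fintype ι] {v : ℝ≥0} (hv : v ≠ 0) :
    Measure.pi (fun _ : ι => complexGaussian 0 v) = volume.withDensity fun z =>
      ENNReal.ofReal (((Real.pi * v)⁻¹) ^ Fintype.card ι *
        Real.exp (-((∑ i, ‖z i‖ ^ 2) / v))) := by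
  have hvp : (0 : ℝ) < v := by positivity
  have hm : Measurable fun z => ENNReal.ofReal (complexGaussianPDF 0 v z) :=
    (measurable_complexGaussianPDF 0 v).ennreal_ofReal
  have h0 : ∀ z, ENNReal.ofReal (complexGaussianPDF 0 v z) ≠ 0 := fun z => by
    simpa using complexGaussianPDF_pos 0 hvp z
  have hvol : (volume : Measure ℂ) = (complexGaussian 0 v).withDensity
      fun z => (ENNReal.ofReal (complexGaussianPDF 0 v z))⁻¹ := by
    rw [complexGaussian_eq_withDensity 0 hv]
    exact (withDensity_inv_same hm (.of_forall h0) (.of_forall fun _ => ENNReal.ofReal_ne_top)).symm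
  have hsf : SigmaFinite ((complexGaussian 0 v).withDensity
      fun z => (ENNReal.ofReal (complexGaussianPDF 0 v z))⁻¹) := by
    rw [← hvol]; infer_instance
  have hpi : (volume : Measure (ι → ℂ)) = (Measure.pi fun _ : ι => complexGaussian 0 v).withDensity
      fun z => ∏ i, (ENNReal.ofReal (complexGaussianPDF 0 v (z i)))⁻¹ := by
    rw [volume_pi, ← pi_withDensity (fun _ : ι => complexGaussian 0 v)
      (f := fun _ z => (ENNReal.ofReal (complexGaussianPDF 0 v z))⁻¹) (fun _ => hm.inv), ← hvol]
  have hprod : ∀ z : ι → ℂ, (∏ i, (ENNReal.ofReal (complexGaussianPDF 0 v (z i)))⁻¹)⁻¹ =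
      ENNReal.ofReal (((Real.pi * v)⁻¹) ^ Fintype.card ι *
        Real.exp (-((∑ i, ‖z i‖ ^ 2) / v))) := by
    intro z
    rw [← ENNReal.prod_inv_distrib (by simp [Set.Pairwise])]
    simp_rw [inv_inv]
    rw [← ENNReal.ofReal_prod_of_nonneg fun i _ => (complexGaussianPDF_pos 0 hvp _).le]
    congr 1
    simp only [complexGaussianPDF, sub_zero]
    rw [Finset.prod_mul_distrib, Finset.prod_const, Finset.card_univ, ← Real.exp_sum,
      Finset.sum_neg_distrib, Finset.sum_div]
  simp_rw [← hprod]
  rw [hpi]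
  refine (withDensity_inv_same (Finset.measurable_prod _ fun i _ =>
    (hm.comp (measurable_pi_apply i)).inv) (.of_forall fun z => ?_) (.of_forall fun z => ?_)).symm
  · exact Finset.prod_ne_zero_iff.2 fun i _ => by simp
  · exact ENNReal.prod_ne_top fun i _ => by simpa using complexGaussianPDF_pos 0 hvp _

/-! ### Linear images of the noise array -/

theorem charFunDual_pi_complexGaussian {ι : Type*} [Fintype ι] [DecidableEq ι] (v : ι → ℝ≥0)
    (K : StrongDual ℝ (ι → ℂ)) :
    charFunDual (Measure.pi fun i => complexGaussian 0 (v i)) K =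
      Complex.exp ((-∑ i, (v i : ℝ) / 4 *
        (K (Pi.single i 1) ^ 2 + K (Pi.single i Complex.I) ^ 2) : ℝ)) := by
  rw [charFunDual_pi]
  simp_rw [charFunDual_complexGaussian]
  rw [← Complex.exp_sum]
  congr 1
  push_cast
  rw [← Finset.sum_neg_distrib]
  refine Finset.sum_congr rfl fun i _ => ?_
  simp

/-- If `X` and `Z` have independent entries `CN(0, p)` and `CN(0, 1)`, then the entries of
`a X + Z` are independent and `CN(0, a² p + 1)`. -/
theorem map_mul_add_pi_complexGaussian {ι : Type*} [Fintype ι] (a : ℝ) (p w : ℝ≥0)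
    (hw : (w : ℝ) = a ^ 2 * p + 1) :
    ((Measure.pi fun _ : ι => complexGaussian 0 p).prod
      (Measure.pi fun _ : ι => complexGaussian 0 1)).map
        (fun y i => (a : ℂ) * y.1 i + y.2 i) = Measure.pi fun _ : ι => complexGaussian 0 w := by
  classical
  have hT : (fun (y : (ι → ℂ) × (ι → ℂ)) i => (a : ℂ) * y.1 i + y.2 i) =
      ⇑(a • ContinuousLinearMap.fst ℝ (ι → ℂ) (ι → ℂ) +
        ContinuousLinearMap.snd ℝ (ι → ℂ) (ι → ℂ)) := by
    ext y i; simp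
  rw [hT]
  have := Measure.isProbabilityMeasure_map (μ := (Measure.pi fun _ : ι => complexGaussian 0 p).prod
      (Measure.pi fun _ : ι => complexGaussian 0 1)) (f := ⇑(a • ContinuousLinearMap.fst ℝ
      (ι → ℂ) (ι → ℂ) + ContinuousLinearMap.snd ℝ (ι → ℂ) (ι → ℂ))) (by fun_prop)
  refine Measure.ext_of_charFunDual (funext fun K => ?_)
  rw [charFunDual_map, charFunDual_prod, charFunDual_pi_complexGaussian,
    charFunDual_pi_complexGaussian, charFunDual_pi_complexGaussian, ← Complex.exp_add,
    ← Complex.ofReal_add]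
  congr 2
  rw [← neg_add, ← Finset.sum_add_distrib]
  congr 1
  refine Finset.sum_congr rfl fun i _ => ?_
  simp [hw]
  ring

/-- The real inner product of two complex arrays. -/
def realInner {a b : ℕ} (w z : Fin a → Fin b → ℂ) : ℝ :=
  ∑ i, ∑ j, ((w i j).re * (z i j).re + (w i j).im * (z i j).im)

/-- The characteristic function of the noise is a function of the norm of its argument. -/
theorem charFunDual_stdNoise {a b : ℕ} (K : StrongDual ℝ (Fin a → Fin b → ℂ))
    (w : Fin a → Fin b → ℂ) (hw : ∀ z, K z = realInner w z) :
    charFunDual (stdNoise a b) K = Complex.exp ((-(realInner w w / 4) : ℝ)) := by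
  rw [stdNoise, charFunDual_pi]
  simp_rw [charFunDual_pi_complexGaussian]
  rw [← Complex.exp_sum, ← Complex.ofReal_sum]
  congr 2
  rw [Finset.sum_neg_distrib, realInner, Finset.sum_div]
  congr 1
  refine Finset.sum_congr rfl fun i _ => ?_
  rw [Finset.sum_div]
  refine Finset.sum_congr rfl fun j _ => ?_
  have key : ∀ x : ℂ, K (Pi.single i (Pi.single j x)) =
      (w i j).re * x.re + (w i j).im * x.im := by
    intro x
    rw [hw, realInner, Finset.sum_eq_single i, Finset.sum_eq_single j]
    · simp
    · intro b _ hb; simp [hb]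
    · simp
    · intro b _ hb; simp [hb]
    · simp
  simp only [ContinuousLinearMap.comp_apply, ContinuousLinearMap.single_apply, key]
  simp
  ring

/-- Every continuous functional on arrays is a real inner product. -/
theorem exists_realInner {a b : ℕ} (K : StrongDual ℝ (Fin a → Fin b → ℂ)) :
    ∃ w : Fin a → Fin b → ℂ, ∀ z, K z = realInner w z := by
  refine ⟨fun i j => ⟨K (Pi.single i (Pi.single j 1)), K (Pi.single i (Pi.single j Complex.I))⟩,
    fun z => ?_⟩
  have hz : z = ∑ i, ∑ j,
      ((z i j).re • (Pi.single i (Pi.single j (1 : ℂ)) : Fin a → Fin b → ℂ) +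
        (z i j).im • (Pi.single i (Pi.single j Complex.I) : Fin a → Fin b → ℂ)) := by
    ext i j
    simp only [Finset.sum_apply, Pi.add_apply, Pi.smul_apply]
    rw [Finset.sum_eq_single i, Finset.sum_eq_single j]
    · simp
    · intro b _ hb; simp [hb.symm]
    · simp
    · intro b _ hb; simp [hb.symm]
    · simp
  conv_lhs => rw [hz]
  simp only [map_sum, map_add, map_smul, realInner, smul_eq_mul]
  exact Finset.sum_congr rfl fun i _ => Finset.sum_congr rfl fun j _ => by ring

/-- The image of the noise under a real linear map whose adjoint is an isometry is again a noise
array with independent standard entries. -/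
theorem map_stdNoise {a b c d : ℕ} (T : (Fin a → Fin b → ℂ) →L[ℝ] (Fin c → Fin d → ℂ))
    (S : (Fin c → Fin d → ℂ) → (Fin a → Fin b → ℂ))
    (hadj : ∀ w z, realInner w (T z) = realInner (S w) z)
    (hS : ∀ w, realInner (S w) (S w) = realInner w w) :
    (stdNoise a b).map T = stdNoise c d := by
  have := Measure.isProbabilityMeasure_map (μ := stdNoise a b) (f := T) (by fun_prop)
  refine Measure.ext_of_charFunDual (funext fun K => ?_)
  obtain ⟨w, hw⟩ := exists_realInner K
  rw [charFunDual_map, charFunDual_stdNoise K w hw,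
    charFunDual_stdNoise (K.comp T) (S w) (fun z => by
      rw [ContinuousLinearMap.comp_apply, hw, hadj]), hS]

/-! ### Poisson weights -/

/-- The Poisson weights `a ^ M e⁻ᵃ / M!` are `O(a ^ (-1/2))`, uniformly in `M`. -/
theorem sqrt_mul_pow_le_exp_mul_factorial {a : ℝ} (ha : 0 < a) (M : ℕ) :
    √a * a ^ M ≤ 2 * Real.exp a * M.factorial := by
  rcases le_or_gt (a / 4) M with hM | hM
  · -- Stirling's bound and `(e a / M) ^ M ≤ eᵃ`
    have hM0 : (0 : ℝ) < M := by linarith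
    have hst := Stirling.le_factorial_stirling M
    have h1 : a ^ M ≤ Real.exp a * (M / Real.exp 1) ^ M := by
      have h2 : a / M ≤ Real.exp (a / M - 1) := by
        have := Real.add_one_le_exp (a / M - 1); linarith
      have h3 : (a / M) ^ M ≤ Real.exp (a - M) := by
        calc (a / M) ^ M ≤ Real.exp (a / M - 1) ^ M := by gcongr
          _ = Real.exp (a - M) := by
            rw [← Real.exp_nat_mul]; congr 1; field_simp
      calc a ^ M = (a / M) ^ M * M ^ M := by rw [div_pow]; field_simp
        _ ≤ Real.exp (a - M) * M ^ M := by gcongr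
        _ = Real.exp a * (M / Real.exp 1) ^ M := by
          rw [Real.exp_sub, div_pow, ← Real.exp_nat_mul, mul_one]; field_simp
    have h4 : √a ≤ √(2 * Real.pi * M) := by
      apply Real.sqrt_le_sqrt
      have := Real.pi_gt_three
      nlinarith
    calc √a * a ^ M ≤ √(2 * Real.pi * M) * (Real.exp a * (M / Real.exp 1) ^ M) := by gcongr
      _ = Real.exp a * (√(2 * Real.pi * M) * (M / Real.exp 1) ^ M) := by ring
      _ ≤ Real.exp a * M.factorial := by gcongr
      _ ≤ 2 * Real.exp a * M.factorial := by
        have : 0 ≤ Real.exp a * M.factorial := by positivity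
        linarith
  · -- the weights of parameter `a` and `a / 2` differ by the factor `2 ^ M ≤ e ^ (a / 4)`
    have h1 : (a / 2) ^ M ≤ Real.exp (a / 2) * M.factorial := by
      have := Real.pow_div_factorial_le_exp (a / 2) (by positivity) M
      rwa [div_le_iff₀ (by positivity)] at this
    have h2 : (2 : ℝ) ^ M ≤ Real.exp (a / 4) := by
      calc (2 : ℝ) ^ M ≤ Real.exp 1 ^ M := by
            gcongr; have := Real.add_one_le_exp (1 : ℝ); linarith
        _ = Real.exp M := by rw [← Real.exp_nat_mul, mul_one]
        _ ≤ Real.exp (a / 4) := Real.exp_le_exp.2 hM.le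
    have h3 : √a ≤ 2 * Real.exp (a / 4) := by
      rw [Real.sqrt_le_left (by positivity)]
      have h4 : (2 * Real.exp (a / 4)) ^ 2 = 4 * Real.exp (a / 2) := by
        rw [mul_pow, ← Real.exp_nat_mul]; norm_num; ring_nf
      rw [h4]
      have := Real.add_one_le_exp (a / 2)
      linarith
    calc √a * a ^ M = √a * (2 ^ M * (a / 2) ^ M) := by rw [← mul_pow]; ring_nf
      _ ≤ 2 * Real.exp (a / 4) * (Real.exp (a / 4) * (Real.exp (a / 2) * M.factorial)) := by
        gcongr
      _ = 2 * (Real.exp (a / 4) * Real.exp (a / 4) * Real.exp (a / 2)) * M.factorial := by ring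
      _ = 2 * Real.exp a * M.factorial := by
        rw [← Real.exp_add, ← Real.exp_add]; ring_nf

/-- The upper bound in Stirling's formula, with the constant `e` that makes it sharp at `n = 1`. -/
theorem factorial_le_exp_mul_sqrt {n : ℕ} (hn : 0 < n) :
    (n.factorial : ℝ) ≤ Real.exp 1 * √n * (n / Real.exp 1) ^ n := by
  obtain ⟨k, rfl⟩ : ∃ k, n = k + 1 := ⟨n - 1, by omega⟩
  have h := Stirling.stirlingSeq'_antitone (Nat.zero_le k)
  simp only [Function.comp_apply, Nat.succ_eq_add_one, zero_add, Stirling.stirlingSeq_one] at h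
  rw [Stirling.stirlingSeq, div_le_iff₀ (by positivity), Real.sqrt_mul (by norm_num)] at h
  refine h.trans_eq ?_
  field_simp

/-- The ratio of the Poisson weight of mean `n s` at `k` to the negative binomial weight of the
same mean is bounded uniformly in `n` and `k`. -/
theorem poisson_le_negBinomial {n : ℕ} (hn : 0 < n) {s : ℝ} (hs : 0 ≤ s) (k : ℕ) :
    Real.exp (-(n * s)) * n ^ k * (n - 1).factorial * (1 + s) ^ (n + k) ≤
      2 * Real.exp 1 * √(1 + s) * (n + k - 1).factorial := by
  have hn' : (0 : ℝ) < n := by exact_mod_cast hn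
  set a : ℝ := n * (1 + s) with ha
  have ha0 : 0 < a := by positivity
  have h1 := sqrt_mul_pow_le_exp_mul_factorial ha0 (n + k - 1)
  have h2 := factorial_le_exp_mul_sqrt hn
  rw [← Nat.mul_factorial_pred hn.ne', Nat.cast_mul] at h2
  have h3 : (n : ℝ) ^ k * (1 + s) ^ (n + k) * n ^ n = a * a ^ (n + k - 1) := by
    rw [← pow_succ', Nat.sub_add_cancel (by omega), ha, mul_pow, pow_add (n : ℝ)]; ring
  have h4 : a = √a * (√n * √(1 + s)) := by
    rw [← Real.sqrt_mul hn'.le, ← ha, Real.mul_self_sqrt ha0.le]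
  have h5 : Real.exp (-(n * s)) = Real.exp (n : ℝ) * (Real.exp a)⁻¹ := by
    rw [← Real.exp_neg, ← Real.exp_add]; congr 1; rw [ha]; ring
  have h6 : (n : ℝ) = √n * √n := (Real.mul_self_sqrt hn'.le).symm
  have hpow : (n / Real.exp 1 : ℝ) ^ n = n ^ n * (Real.exp n)⁻¹ := by
    rw [div_pow, ← Real.exp_nat_mul, mul_one]; rfl
  rw [hpow] at h2
  have hsn : 0 < √(n : ℝ) := Real.sqrt_pos.2 hn'
  -- multiply by `n ^ n · n` to make both bounds applicable
  have hpos : (0 : ℝ) < n ^ n * n := by positivity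
  refine le_of_mul_le_mul_right ?_ hpos
  calc Real.exp (-(n * s)) * n ^ k * (n - 1).factorial * (1 + s) ^ (n + k) * (n ^ n * n)
      = Real.exp (-(n * s)) * ((n : ℝ) ^ k * (1 + s) ^ (n + k) * n ^ n) *
          (n * (n - 1).factorial) := by ring
    _ ≤ Real.exp (-(n * s)) * (a * a ^ (n + k - 1)) *
          (Real.exp 1 * √n * (n ^ n * (Real.exp n)⁻¹)) := by
        rw [h3]; gcongr
    _ = Real.exp 1 * √(1 + s) * (√n * √n) * n ^ n * (Real.exp a)⁻¹ *
          (√a * a ^ (n + k - 1)) := by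
        rw [h5]; nth_rewrite 2 [h4]; field_simp
    _ ≤ Real.exp 1 * √(1 + s) * (√n * √n) * n ^ n * (Real.exp a)⁻¹ *
          (2 * Real.exp a * (n + k - 1).factorial) := by gcongr
    _ = 2 * Real.exp 1 * √(1 + s) * (n + k - 1).factorial * (n ^ n * n) := by
        rw [← h6]; field_simp

/-! ### Radial integrals -/

theorem lintegral_radial_gaussian {N : ℕ} (hN : 0 < N) {b : ℝ} (hb : 0 < b) :
    ∫⁻ x in Set.Ioi (0 : ℝ), ENNReal.ofReal (x ^ (2 * N - 1) * Real.exp (-(b * x ^ 2))) =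
      ENNReal.ofReal ((N - 1).factorial / (2 * b ^ N)) := by
  have hN' : (0 : ℝ) < N := by exact_mod_cast hN
  have hq : (-1 : ℝ) < 2 * N - 1 := by linarith
  have hfun : ∀ x ∈ Set.Ioi (0 : ℝ), x ^ (2 * N - 1) * Real.exp (-(b * x ^ 2)) =
      x ^ (2 * N - 1 : ℝ) * Real.exp (-b * x ^ (2 : ℝ)) := by
    intro x hx
    rw [← Real.rpow_natCast, ← Real.rpow_natCast, Nat.cast_sub (by omega)]
    push_cast
    ring_nf
  have hint := integrableOn_rpow_mul_exp_neg_mul_rpow hq two_pos hb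
  have hval := integral_rpow_mul_exp_neg_mul_rpow (p := 2) two_pos hq hb
  rw [setLIntegral_congr_fun measurableSet_Ioi (fun x hx => by
    rw [hfun x hx]), ← ofReal_integral_eq_lintegral_ofReal hint, hval]
  · congr 1
    have : ((2 * N - 1 : ℝ) + 1) / 2 = N := by ring
    rw [neg_div, this, Real.rpow_neg hb.le, Real.rpow_natCast]
    obtain ⟨k, rfl⟩ : ∃ k, N = k + 1 := ⟨N - 1, by omega⟩
    rw [Nat.cast_add_one, Real.Gamma_nat_eq_factorial]
    simp only [Nat.add_sub_cancel]
    field_simp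
  · filter_upwards [ae_restrict_mem measurableSet_Ioi] with x hx
    have : (0 : ℝ) < x := hx
    positivity

/-- A hyperbolic cosine at radius `√(n p)` is dominated by its average over the radial law of a
complex Gaussian vector in dimension `n` with entries `CN(0, p)`: this holds for every term of the
power series. -/
theorem cosh_le_lintegral_radial {n : ℕ} (hn : 0 < n) {p g : ℝ} (hp : 0 < p) (hg : 0 ≤ g) (c : ℝ) :
    ENNReal.ofReal (p ^ n * (n - 1).factorial / 2 *
        (Real.exp (-(n * (g * p))) * Real.cosh (√(n * p) * c))) ≤
      ENNReal.ofReal (2 * Real.exp 1 * √(1 + g * p)) *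
        ∫⁻ x in Set.Ioi (0 : ℝ), ENNReal.ofReal (x ^ (2 * n - 1) * Real.exp (-(x ^ 2 / p)) *
          (Real.exp (-(g * x ^ 2)) * Real.cosh (x * c))) := by
  have hs : 0 ≤ g * p := by positivity
  have hb : 0 < 1 / p + g := by positivity
  have hsum1 : HasSum (fun k : ℕ => p ^ n * (n - 1).factorial / 2 *
      (Real.exp (-(n * (g * p))) * ((√(n * p) * c) ^ (2 * k) / (2 * k).factorial)))
      (p ^ n * (n - 1).factorial / 2 *
        (Real.exp (-(n * (g * p))) * Real.cosh (√(n * p) * c))) :=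
    ((Real.hasSum_cosh _).mul_left _).mul_left _
  have hsum2 : ∀ x ∈ Set.Ioi (0 : ℝ),
      ENNReal.ofReal (x ^ (2 * n - 1) * Real.exp (-(x ^ 2 / p)) *
        (Real.exp (-(g * x ^ 2)) * Real.cosh (x * c))) =
      ∑' k : ℕ, ENNReal.ofReal (x ^ (2 * (n + k) - 1) * Real.exp (-((1 / p + g) * x ^ 2))) *
        ENNReal.ofReal (c ^ (2 * k) / (2 * k).factorial) := by
    intro x hx
    have hx0 : (0 : ℝ) < x := hx
    have h := (((Real.hasSum_cosh (x * c)).mul_left (Real.exp (-(g * x ^ 2)))).mul_left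
      (x ^ (2 * n - 1) * Real.exp (-(x ^ 2 / p))))
    have hterm : ∀ k : ℕ, x ^ (2 * n - 1) * Real.exp (-(x ^ 2 / p)) *
        (Real.exp (-(g * x ^ 2)) * ((x * c) ^ (2 * k) / (2 * k).factorial)) =
        x ^ (2 * (n + k) - 1) * Real.exp (-((1 / p + g) * x ^ 2)) *
          (c ^ (2 * k) / (2 * k).factorial) := by
      intro k
      rw [show 2 * (n + k) - 1 = (2 * n - 1) + 2 * k by omega, pow_add, mul_pow,
        show -((1 / p + g) * x ^ 2) = -(x ^ 2 / p) + -(g * x ^ 2) by ring, Real.exp_add]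
      ring
    simp_rw [hterm] at h
    rw [← h.tsum_eq, ENNReal.ofReal_tsum_of_nonneg _ h.summable]
    · refine tsum_congr fun k => ENNReal.ofReal_mul (by positivity)
    · intro k
      have : 0 ≤ c ^ (2 * k) := by rw [pow_mul]; positivity
      positivity
  have hck : ∀ k : ℕ, 0 ≤ c ^ (2 * k) := fun k => by rw [pow_mul]; positivity
  rw [setLIntegral_congr_fun measurableSet_Ioi hsum2, lintegral_tsum (fun k => by fun_prop),
    ← ENNReal.tsum_mul_left, ← hsum1.tsum_eq, ENNReal.ofReal_tsum_of_nonneg _ hsum1.summable]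
  · refine ENNReal.tsum_le_tsum fun k => ?_
    rw [lintegral_mul_const _ (by fun_prop), lintegral_radial_gaussian (by omega) hb,
      ← ENNReal.ofReal_mul (by positivity), ← ENNReal.ofReal_mul (by positivity)]
    refine ENNReal.ofReal_le_ofReal ?_
    have key := poisson_le_negBinomial hn hs k
    have hbp : (1 / p + g) ^ (n + k) = (1 + g * p) ^ (n + k) / p ^ (n + k) := by
      rw [← div_pow]; congr 1; field_simp
    have hsq : √(n * p) ^ (2 * k) = (n : ℝ) ^ k * p ^ k := by
      rw [pow_mul, Real.sq_sqrt (by positivity), mul_pow]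
    have hden : (0 : ℝ) < (1 + g * p) ^ (n + k) := by positivity
    rw [mul_pow, hsq, hbp]
    calc p ^ n * (n - 1).factorial / 2 * (Real.exp (-(n * (g * p))) *
          ((n : ℝ) ^ k * p ^ k * c ^ (2 * k) / (2 * k).factorial))
        = (Real.exp (-(n * (g * p))) * n ^ k * (n - 1).factorial * (1 + g * p) ^ (n + k)) *
          (p ^ (n + k) / (2 * (1 + g * p) ^ (n + k)) * (c ^ (2 * k) / (2 * k).factorial)) := by
          rw [pow_add p]; field_simp
      _ ≤ (2 * Real.exp 1 * √(1 + g * p) * (n + k - 1).factorial) *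
          (p ^ (n + k) / (2 * (1 + g * p) ^ (n + k)) * (c ^ (2 * k) / (2 * k).factorial)) := by
          have := hck k
          gcongr
      _ = _ := by field_simp
  · intro k
    have : 0 ≤ (√(n * p) * c) ^ (2 * k) := by rw [pow_mul]; positivity
    positivity

/-- Integration in polar coordinates in `ℂⁿ`. -/
theorem lintegral_polar {n : ℕ} (hn : 0 < n) :
    ∃ σ : Measure (Fin n → ℂ), IsFiniteMeasure σ ∧ (∀ᵐ u ∂σ, ∑ i, ‖u i‖ ^ 2 = 1) ∧
      ∀ f : (Fin n → ℂ) → ℝ≥0∞, Measurable f → (∫⁻ x, f x) =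
        ∫⁻ u, (∫⁻ x in Set.Ioi (0 : ℝ), ENNReal.ofReal (x ^ (2 * n - 1)) * f (x • u)) ∂σ := by
  let e : EuclideanSpace ℂ (Fin n) ≃L[ℝ] (Fin n → ℂ) := PiLp.continuousLinearEquiv 2 ℝ fun _ => ℂ
  let μ : Measure (EuclideanSpace ℂ (Fin n)) := volume.map e.symm
  have hμ : μ.IsAddHaarMeasure := e.symm.isAddHaarMeasure_map volume
  have hdim : Module.finrank ℝ (EuclideanSpace ℂ (Fin n)) = 2 * n := by
    rw [e.toLinearEquiv.finrank_eq, Module.finrank_pi_fintype]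
    simp [mul_comm]
  have hnt : Nontrivial (EuclideanSpace ℂ (Fin n)) :=
    Module.nontrivial_of_finrank_pos (R := ℝ) (by omega)
  let ι : Metric.sphere (0 : EuclideanSpace ℂ (Fin n)) 1 → (Fin n → ℂ) := fun u => e u.1
  have hι : Measurable ι := e.continuous.measurable.comp measurable_subtype_coe
  refine ⟨μ.toSphere.map ι, inferInstance, ?_, fun f hf => ?_⟩
  · refine (ae_map_iff hι.aemeasurable (measurableSet_eq_fun (by fun_prop) measurable_const)).2
      (.of_forall fun u => ?_)
    have h1 : ‖u.1‖ = 1 := by simp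
    have h2 := EuclideanSpace.norm_sq_eq u.1
    rw [h1, one_pow] at h2
    exact h2.symm
  · have hfe : Measurable fun y : EuclideanSpace ℂ (Fin n) => f (e y) :=
      hf.comp e.continuous.measurable
    have h1 : (∫⁻ x, f x) = ∫⁻ y, f (e y) ∂μ := by
      rw [lintegral_map hfe e.symm.continuous.measurable]
      simp
    have h2 : ∫⁻ y, f (e y) ∂μ =
        ∫⁻ y : ({0}ᶜ : Set (EuclideanSpace ℂ (Fin n))), f (e y.1) ∂(μ.comap (↑)) := by
      rw [lintegral_subtype_comap (measurableSet_singleton _).compl (fun y => f (e y)),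
        restrict_compl_singleton]
    have h3 := (μ.measurePreserving_homeomorphUnitSphereProd).lintegral_comp
      (f := fun q => f (q.2.1 • ι q.1)) (by fun_prop)
    have h4 : ∀ y : ({0}ᶜ : Set (EuclideanSpace ℂ (Fin n))),
        ((homeomorphUnitSphereProd (EuclideanSpace ℂ (Fin n)) y).2.1 •
          ι (homeomorphUnitSphereProd (EuclideanSpace ℂ (Fin n)) y).1) = e y.1 := by
      intro y
      have hy : ‖y.1‖ ≠ 0 := norm_ne_zero_iff.2 y.2
      simp only [ι, homeomorphUnitSphereProd_apply_snd_coe, homeomorphUnitSphereProd_apply_fst_coe,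
        map_smul, smul_smul, mul_inv_cancel₀ hy, one_smul]
    simp_rw [h4] at h3
    rw [h1, h2, h3, lintegral_prod _ (by fun_prop), hdim, lintegral_map _ hι]
    · refine lintegral_congr fun u => ?_
      rw [Measure.volumeIoiPow, lintegral_withDensity_eq_lintegral_mul _ (by fun_prop)
        (by fun_prop), ← lintegral_subtype_comap measurableSet_Ioi]
      rfl
    · refine Measurable.lintegral_prod_right' (f := fun q : (Fin n → ℂ) × ℝ =>
        ENNReal.ofReal (q.2 ^ (2 * n - 1)) * f (q.2 • q.1)) ?_
      fun_prop

/-! ### Uniform inputs on a sphere -/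

theorem map_add_pi_complexGaussian {ι : Type*} [Fintype ι] (c : ι → ℂ) (v : ℝ≥0) :
    (Measure.pi fun _ : ι => complexGaussian 0 v).map (fun z i => c i + z i) =
      Measure.pi fun i => complexGaussian (c i) v := by
  have (i : ι) : IsProbabilityMeasure ((complexGaussian 0 v).map (c i + ·)) := by
    rw [map_const_add_complexGaussian]; infer_instance
  rw [Measure.pi_map_pi (f := fun i z => c i + z) (fun i => by fun_prop)]
  simp_rw [map_const_add_complexGaussian]

/-- The Cameron-Martin formula for a vector of independent `CN(0, 1)` variables. -/
theorem lintegral_add_pi_complexGaussian {ι : Type*} [Fintype ι] (c : ι → ℂ)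
    {f : (ι → ℂ) → ℝ≥0∞} (hf : Measurable f) :
    ∫⁻ z, f (fun i => c i + z i) ∂(Measure.pi fun _ : ι => complexGaussian 0 1) =
      ∫⁻ y, ENNReal.ofReal (Real.exp (-(∑ i, ‖c i‖ ^ 2)) *
        Real.exp (2 * ∑ i, ((c i).re * (y i).re + (c i).im * (y i).im))) * f y
        ∂(Measure.pi fun _ : ι => complexGaussian 0 1) := by
  have hsf (i : ι) : SigmaFinite ((complexGaussian 0 1).withDensity fun z =>
      ENNReal.ofReal (((1 : ℝ≥0) : ℝ) / (1 : ℝ≥0) *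
        Real.exp (‖z - 0‖ ^ 2 / (1 : ℝ≥0) - ‖z - c i‖ ^ 2 / (1 : ℝ≥0)))) := by
    rw [← complexGaussian_eq_withDensity_complexGaussian _ _ one_ne_zero one_ne_zero]
    infer_instance
  rw [← lintegral_map (μ := Measure.pi fun _ : ι => complexGaussian 0 1)
    (g := fun z i => c i + z i) hf (by fun_prop), map_add_pi_complexGaussian]
  simp_rw [fun i => complexGaussian_eq_withDensity_complexGaussian (c i) 0
    (one_ne_zero (α := ℝ≥0)) one_ne_zero]
  rw [pi_withDensity _ (fun i => by fun_prop), lintegral_withDensity_eq_lintegral_mul _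
    (Finset.measurable_prod _ fun i _ => by fun_prop) hf]
  refine lintegral_congr fun y => ?_
  rw [Pi.mul_apply]
  congr 1
  rw [← ENNReal.ofReal_prod_of_nonneg fun i _ => by positivity]
  congr 1
  simp only [NNReal.coe_one, div_one, one_mul, sub_zero]
  rw [← Real.exp_sum, ← Real.exp_add]
  congr 1
  rw [Finset.mul_sum, ← Finset.sum_neg_distrib, ← Finset.sum_add_distrib]
  refine Finset.sum_congr rfl fun i _ => ?_
  rw [Complex.sq_norm, Complex.sq_norm, Complex.sq_norm, Complex.normSq_apply,
    Complex.normSq_apply, Complex.normSq_apply]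
  simp
  ring

theorem map_neg_pi_complexGaussian {ι : Type*} [Fintype ι] (v : ℝ≥0) :
    (Measure.pi fun _ : ι => complexGaussian 0 v).map (fun z => -z) =
      Measure.pi fun _ : ι => complexGaussian 0 v := by
  have h1 : (complexGaussian 0 v).map (fun z => -z) = complexGaussian 0 v := by
    have := map_mul_complexGaussian (-1) v
    simpa using this
  have (i : ι) : IsProbabilityMeasure ((complexGaussian 0 v).map (fun z => -z)) := by
    rw [h1]; infer_instance
  have h := Measure.pi_map_pi (μ := fun _ : ι => complexGaussian 0 v)
    (f := fun _ z => -z) (fun i => by fun_prop)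
  simp_rw [h1] at h
  exact h

/-- For every `p` there is a law on the sphere `∑ ‖x i‖² = n p` (the symmetrized uniform one) under
which the output law `√g x + CN(0, 1)ⁿ` is dominated by the output law of the Gaussian input
`CN(0, p)ⁿ`, with a constant that does not depend on `n`. -/
theorem exists_sphere_mixture {n : ℕ} (hn : 0 < n) {p g : ℝ} (hp : 0 ≤ p) (hg : 0 ≤ g) :
    ∃ π : Measure (Fin n → ℂ), IsProbabilityMeasure π ∧ (∀ᵐ x ∂π, ∑ i, ‖x i‖ ^ 2 = n * p) ∧
      (π.prod (Measure.pi fun _ : Fin n => complexGaussian 0 1)).map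
          (fun y i => (√g : ℂ) * y.1 i + y.2 i) ≤
        ENNReal.ofReal (2 * Real.exp 1 * √(1 + g * p)) •
          Measure.pi fun _ : Fin n => complexGaussian 0 (1 + g * p).toNNReal := by
  rcases hp.eq_or_lt with rfl | hp
  · refine ⟨Measure.dirac 0, inferInstance, ?_, ?_⟩
    · rw [ae_dirac_iff (measurableSet_eq_fun (by fun_prop) measurable_const)]
      simp
    · rw [Measure.dirac_prod, Measure.map_map (by fun_prop) (by fun_prop)]
      have : ((fun (y : (Fin n → ℂ) × (Fin n → ℂ)) i => (√g : ℂ) * y.1 i + y.2 i) ∘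
          Prod.mk 0) = id := by ext; simp
      rw [this, Measure.map_id]
      simp only [mul_zero, add_zero, Real.toNNReal_one, Real.sqrt_one, mul_one]
      refine Measure.le_iff.2 fun s _ => ?_
      rw [Measure.smul_apply, smul_eq_mul]
      refine le_mul_of_one_le_left zero_le ?_
      rw [ENNReal.one_le_ofReal]
      have := Real.add_one_le_exp (1 : ℝ)
      linarith
  obtain ⟨σ, hσfin, hσ, hpolar⟩ := lintegral_polar hn
  set γ : Measure (Fin n → ℂ) := Measure.pi fun _ => complexGaussian 0 1 with hγ
  set pp : ℝ≥0 := p.toNNReal with hpp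
  have hppp : (pp : ℝ) = p := Real.coe_toNNReal _ hp.le
  have hpp0 : pp ≠ 0 := by simpa [hpp] using hp
  set ρ : ℝ := √(n * p) with hρ
  set K : ℝ := p ^ n * (n - 1).factorial / 2 with hK
  have hK0 : 0 < K := by positivity
  set D : ℝ := ((Real.pi * p)⁻¹) ^ n with hD
  have hD0 : 0 < D := by have := Real.pi_pos; positivity
  set Cc : ℝ := 2 * Real.exp 1 * √(1 + g * p) with hC
  -- the law of the Gaussian input in polar coordinates
  have hgauss : ∀ f : (Fin n → ℂ) → ℝ≥0∞, Measurable f →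
      ∫⁻ x, f x ∂(Measure.pi fun _ : Fin n => complexGaussian 0 pp) = ENNReal.ofReal D *
        ∫⁻ u, (∫⁻ r in Set.Ioi (0 : ℝ), ENNReal.ofReal (r ^ (2 * n - 1) *
          Real.exp (-(r ^ 2 / p))) * f (r • u)) ∂σ := by
    intro f hf
    rw [pi_complexGaussian_eq_withDensity hpp0,
      lintegral_withDensity_eq_lintegral_mul _ (by fun_prop) hf]
    simp only [Pi.mul_apply, Fintype.card_fin, hppp]
    rw [hpolar _ (by fun_prop), ← lintegral_const_mul']
    swap; · exact ENNReal.ofReal_ne_top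
    refine lintegral_congr_ae ?_
    filter_upwards [hσ] with u hu
    rw [← lintegral_const_mul' _ _ ENNReal.ofReal_ne_top]
    refine setLIntegral_congr_fun measurableSet_Ioi fun r hr => ?_
    have hr0 : (0 : ℝ) < r := hr
    have : ∑ i, ‖(r • u) i‖ ^ 2 = r ^ 2 := by
      simp only [Pi.smul_apply, norm_smul, mul_pow]
      rw [← Finset.mul_sum, hu]; simp
    rw [this, ← mul_assoc, ← mul_assoc, ← ENNReal.ofReal_mul (by positivity),
      ← ENNReal.ofReal_mul (by positivity)]
    congr 2; ring
  -- normalization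
  have hmass : ENNReal.ofReal D * (ENNReal.ofReal K * σ Set.univ) = 1 := by
    have h1 := hgauss (fun _ => 1) measurable_const
    have h2 := lintegral_radial_gaussian hn (b := 1 / p) (by positivity)
    have h3 : ∫⁻ r in Set.Ioi (0 : ℝ), ENNReal.ofReal (r ^ (2 * n - 1) *
          Real.exp (-(r ^ 2 / p))) * 1 = ENNReal.ofReal K := by
      simp only [mul_one]
      rw [hK, show p ^ n * ((n - 1).factorial : ℝ) / 2 =
        (n - 1).factorial / (2 * (1 / p) ^ n) by rw [div_pow, one_pow]; field_simp, ← h2]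
      refine lintegral_congr fun r => ?_
      congr 4; ring
    rw [h3, lintegral_const, lintegral_const, measure_univ, mul_one] at h1
    exact h1.symm
  have hS0 : σ Set.univ ≠ 0 := by
    intro h; rw [h] at hmass; simp at hmass
  have hSt : σ Set.univ ≠ ∞ := measure_ne_top _ _
  have hm1 : Measurable fun u : Fin n → ℂ => ρ • u := by fun_prop
  have hm2 : Measurable fun u : Fin n → ℂ => -(ρ • u) := by fun_prop
  set π : Measure (Fin n → ℂ) := (2 * σ Set.univ)⁻¹ •
    (σ.map (fun u => ρ • u) + σ.map (fun u => -(ρ • u))) with hπ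
  have hπint : ∀ f : (Fin n → ℂ) → ℝ≥0∞, Measurable f →
      ∫⁻ x, f x ∂π = (2 * σ Set.univ)⁻¹ * ∫⁻ u, (f (ρ • u) + f (-(ρ • u))) ∂σ := by
    intro f hf
    rw [hπ, lintegral_smul_measure, lintegral_add_measure, lintegral_map hf hm1,
      lintegral_map hf hm2, lintegral_add_left (by fun_prop), smul_eq_mul]
  have h2S0 : 2 * σ Set.univ ≠ 0 := mul_ne_zero two_ne_zero hS0
  have h2St : 2 * σ Set.univ ≠ ∞ := ENNReal.mul_ne_top ENNReal.ofNat_ne_top hSt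
  have hπprob : IsProbabilityMeasure π := by
    constructor
    have := hπint (fun _ => 1) measurable_const
    rw [lintegral_const, lintegral_const, one_mul, one_add_one_eq_two] at this
    rw [this, ENNReal.inv_mul_cancel h2S0 h2St]
  refine ⟨π, hπprob, ?_, ?_⟩
  · have hnorm : ∀ᵐ u ∂σ, ∑ i, ‖(ρ • u) i‖ ^ 2 = n * p := by
      filter_upwards [hσ] with u hu
      simp only [Pi.smul_apply, norm_smul, mul_pow]
      rw [← Finset.mul_sum, hu, mul_one, Real.norm_eq_abs, sq_abs, Real.sq_sqrt (by positivity)]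
    have hset : MeasurableSet {x : Fin n → ℂ | ∑ i, ‖x i‖ ^ 2 = n * p} :=
      measurableSet_eq_fun (by fun_prop) measurable_const
    refine Measure.ae_smul_measure ?_ _
    rw [ae_add_measure_iff]
    refine ⟨(ae_map_iff hm1.aemeasurable hset).2 hnorm, (ae_map_iff hm2.aemeasurable hset).2 ?_⟩
    filter_upwards [hnorm] with u hu
    simpa using hu
  refine Measure.le_iff.2 fun A hA => ?_
  set f : (Fin n → ℂ) → ℝ≥0∞ := A.indicator 1 with hf
  have hfm : Measurable f := measurable_one.indicator hA
  set Ψ : (Fin n → ℂ) → ℝ≥0∞ := fun x => ∫⁻ z, f (fun i => (√g : ℂ) * x i + z i) ∂γ with hΨ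
  have hΨm : Measurable Ψ := by
    refine Measurable.lintegral_prod_right' (f := fun q : (Fin n → ℂ) × (Fin n → ℂ) =>
      f (fun i => (√g : ℂ) * q.1 i + q.2 i)) ?_
    fun_prop
  have hmix : ∀ (π' : Measure (Fin n → ℂ)) [IsProbabilityMeasure π'],
      (π'.prod γ).map (fun y i => (√g : ℂ) * y.1 i + y.2 i) A = ∫⁻ x, Ψ x ∂π' := by
    intro π' _
    have hmm : Measurable fun (y : (Fin n → ℂ) × (Fin n → ℂ)) i => (√g : ℂ) * y.1 i + y.2 i := by
      fun_prop
    rw [← lintegral_indicator_one hA, lintegral_map hfm hmm]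
    exact lintegral_prod _ (hfm.comp hmm).aemeasurable
  let B : (Fin n → ℂ) → (Fin n → ℂ) → ℝ := fun x y =>
    ∑ i, ((x i).re * (y i).re + (x i).im * (y i).im)
  -- the density of the symmetrized output law on the ray through `u`
  have hsym : ∀ (u : Fin n → ℂ) (_ : ∑ i, ‖u i‖ ^ 2 = 1) (r : ℝ),
      Ψ (r • u) + Ψ (-(r • u)) = ∫⁻ y, ENNReal.ofReal (2 * (Real.exp (-(g * r ^ 2)) *
        Real.cosh (r * (2 * √g * B u y)))) * f y ∂γ := by
    intro u hu r
    have hone : ∀ s : ℝ, Ψ (s • u) = ∫⁻ y, ENNReal.ofReal (Real.exp (-(g * s ^ 2)) *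
        Real.exp (s * (2 * √g * B u y))) * f y ∂γ := by
      intro s
      rw [hΨ]
      dsimp only
      rw [hγ, lintegral_add_pi_complexGaussian (fun i => (√g : ℂ) * (s • u) i) hfm]
      refine lintegral_congr fun y => ?_
      congr 4
      · rw [neg_inj, ← mul_one (g * s ^ 2), ← hu, Finset.mul_sum]
        refine Finset.sum_congr rfl fun i _ => ?_
        rw [norm_mul, mul_pow, Pi.smul_apply, norm_smul, mul_pow, Complex.norm_real,
          Real.norm_eq_abs, Real.norm_eq_abs, sq_abs, sq_abs, Real.sq_sqrt hg]
        ring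
      · simp only [B, Finset.mul_sum]
        refine Finset.sum_congr rfl fun i _ => ?_
        simp
        ring
    rw [← neg_smul, hone, hone, ← lintegral_add_left (by fun_prop)]
    refine lintegral_congr fun y => ?_
    rw [← add_mul, ← ENNReal.ofReal_add (by positivity) (by positivity)]
    congr 2
    rw [Real.cosh_eq, neg_sq, neg_mul]
    ring
  have hray : ∀ (u : Fin n → ℂ) (_ : ∑ i, ‖u i‖ ^ 2 = 1),
      ENNReal.ofReal K * (Ψ (ρ • u) + Ψ (-(ρ • u))) ≤ ENNReal.ofReal Cc *
        ∫⁻ r in Set.Ioi (0 : ℝ), ENNReal.ofReal (r ^ (2 * n - 1) * Real.exp (-(r ^ 2 / p))) *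
          (Ψ (r • u) + Ψ (-(r • u))) := by
    intro u hu
    have hBm : Measurable fun y => B u y := by fun_prop
    simp_rw [hsym u hu]
    have e1 : ∀ r : ℝ, ENNReal.ofReal (r ^ (2 * n - 1) * Real.exp (-(r ^ 2 / p))) *
        ∫⁻ y, ENNReal.ofReal (2 * (Real.exp (-(g * r ^ 2)) *
          Real.cosh (r * (2 * √g * B u y)))) * f y ∂γ =
        ∫⁻ y, 2 * f y * ENNReal.ofReal (r ^ (2 * n - 1) * Real.exp (-(r ^ 2 / p)) *
          (Real.exp (-(g * r ^ 2)) * Real.cosh (r * (2 * √g * B u y)))) ∂γ := by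
      intro r
      rw [← lintegral_const_mul' _ _ ENNReal.ofReal_ne_top]
      refine lintegral_congr fun y => ?_
      have hc := Real.cosh_pos (r * (2 * √g * B u y))
      rw [ENNReal.ofReal_mul (by norm_num : (0 : ℝ) ≤ 2), ENNReal.ofReal_ofNat,
        ENNReal.ofReal_mul' (q := Real.exp (-(g * r ^ 2)) * _) (by positivity)]
      ring
    simp_rw [e1]
    rw [lintegral_lintegral_swap (by fun_prop), ← lintegral_const_mul' _ _ ENNReal.ofReal_ne_top,
      ← lintegral_const_mul' _ _ ENNReal.ofReal_ne_top]
    refine lintegral_mono fun y => ?_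
    have key := cosh_le_lintegral_radial hn hp hg (2 * √g * B u y)
    have hρ2 : ρ ^ 2 = n * p := Real.sq_sqrt (by positivity)
    have hc := Real.cosh_pos (ρ * (2 * √g * B u y))
    rw [lintegral_const_mul _ (by fun_prop)]
    calc ENNReal.ofReal K * (ENNReal.ofReal (2 * (Real.exp (-(g * ρ ^ 2)) *
          Real.cosh (ρ * (2 * √g * B u y)))) * f y)
        = 2 * f y * ENNReal.ofReal (K * (Real.exp (-(n * (g * p))) *
          Real.cosh (ρ * (2 * √g * B u y)))) := by
          rw [ENNReal.ofReal_mul (by norm_num : (0 : ℝ) ≤ 2), ENNReal.ofReal_ofNat,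
            ENNReal.ofReal_mul hK0.le, hρ2, show g * (n * p) = n * (g * p) by ring]
          ring
      _ ≤ 2 * f y * _ := mul_le_mul_right key _
      _ = _ := by ring
  -- integrate over the directions
  have hνA : (Measure.pi fun _ : Fin n => complexGaussian 0 (1 + g * p).toNNReal) A =
      ∫⁻ x, Ψ x ∂(Measure.pi fun _ : Fin n => complexGaussian 0 pp) := by
    rw [← hmix, hγ, map_mul_add_pi_complexGaussian]
    rw [Real.coe_toNNReal _ (by positivity), hppp, Real.sq_sqrt hg]
    ring
  have hνneg : ∫⁻ x, Ψ (-x) ∂(Measure.pi fun _ : Fin n => complexGaussian 0 pp) =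
      ∫⁻ x, Ψ x ∂(Measure.pi fun _ : Fin n => complexGaussian 0 pp) := by
    conv_rhs => rw [← map_neg_pi_complexGaussian, lintegral_map hΨm measurable_neg]
  have hν2 : 2 * (Measure.pi fun _ : Fin n => complexGaussian 0 (1 + g * p).toNNReal) A =
      ENNReal.ofReal D * ∫⁻ u, (∫⁻ r in Set.Ioi (0 : ℝ), ENNReal.ofReal (r ^ (2 * n - 1) *
          Real.exp (-(r ^ 2 / p))) * (Ψ (r • u) + Ψ (-(r • u)))) ∂σ := by
    rw [← hgauss (fun x => Ψ x + Ψ (-x)) (by fun_prop), lintegral_add_left hΨm, hνneg, ← hνA,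
      two_mul]
  have hint : ENNReal.ofReal K * ∫⁻ u, (Ψ (ρ • u) + Ψ (-(ρ • u))) ∂σ ≤
      ENNReal.ofReal Cc * ∫⁻ u, (∫⁻ r in Set.Ioi (0 : ℝ), ENNReal.ofReal (r ^ (2 * n - 1) *
          Real.exp (-(r ^ 2 / p))) * (Ψ (r • u) + Ψ (-(r • u)))) ∂σ := by
    rw [← lintegral_const_mul' _ _ ENNReal.ofReal_ne_top,
      ← lintegral_const_mul' _ _ ENNReal.ofReal_ne_top]
    refine lintegral_mono_ae ?_
    filter_upwards [hσ] with u hu using hray u hu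
  rw [hmix π, hπint Ψ hΨm, Measure.smul_apply, smul_eq_mul, ENNReal.inv_mul_le_iff h2S0 h2St]
  set J := ∫⁻ u, (Ψ (ρ • u) + Ψ (-(ρ • u))) ∂σ
  calc J = ENNReal.ofReal D * (ENNReal.ofReal K * σ Set.univ) * J := by rw [hmass, one_mul]
    _ = σ Set.univ * (ENNReal.ofReal D * (ENNReal.ofReal K * J)) := by ring
    _ ≤ σ Set.univ * (ENNReal.ofReal D * (ENNReal.ofReal Cc * _)) := by gcongr
    _ = _ := by rw [mul_left_comm (ENNReal.ofReal D), ← hν2]; ring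

/-! ### Output laws of the eigen-channels -/

theorem map_transpose_stdNoise (a b : ℕ) :
    (stdNoise a b).map (fun Z i j => Z j i) = stdNoise b a := by
  let T : (Fin a → Fin b → ℂ) →L[ℝ] (Fin b → Fin a → ℂ) :=
    ContinuousLinearMap.pi fun i => ContinuousLinearMap.pi fun j =>
      (ContinuousLinearMap.proj (R := ℝ) (φ := fun _ : Fin b => ℂ) i).comp
        (ContinuousLinearMap.proj (R := ℝ) (φ := fun _ : Fin a => Fin b → ℂ) j)
  exact map_stdNoise T (fun w i j => w j i) (fun w z => Finset.sum_comm)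
    (fun w => Finset.sum_comm)

theorem pi_pi_map {a b : ℕ} (f : Fin a → Fin b → ℂ → ℂ) (hf : ∀ i j, Measurable (f i j)) :
    (stdNoise a b).map (fun Z i j => f i j (Z i j)) =
      Measure.pi fun i => Measure.pi fun j => (complexGaussian 0 1).map (f i j) := by
  have h1 (i : Fin a) (j : Fin b) : IsProbabilityMeasure ((complexGaussian 0 1).map (f i j)) :=
    Measure.isProbabilityMeasure_map (hf i j).aemeasurable
  have h2 (i : Fin a) := Measure.pi_map_pi (μ := fun _ : Fin b => complexGaussian 0 1)
    (f := f i) (fun j => (hf i j).aemeasurable)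
  have h3 (i : Fin a) : Measurable fun (z : Fin b → ℂ) j => f i j (z j) :=
    measurable_pi_lambda _ fun j => (hf i j).comp (measurable_pi_apply j)
  have h4 (i : Fin a) : IsProbabilityMeasure ((Measure.pi fun _ : Fin b =>
      complexGaussian 0 1).map (fun z j => f i j (z j))) :=
    Measure.isProbabilityMeasure_map (h3 i).aemeasurable
  rw [stdNoise, Measure.pi_map_pi (f := fun i (z : Fin b → ℂ) j => f i j (z j))
    (fun i => (h3 i).aemeasurable)]
  simp_rw [h2]

theorem map_scale_stdNoise {a b : ℕ} (c : Fin a → Fin b → ℝ) (v : Fin a → Fin b → ℝ≥0)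
    (hv : ∀ i j, (v i j : ℝ) = c i j ^ 2) :
    (stdNoise a b).map (fun Z i j => (c i j : ℂ) * Z i j) =
      Measure.pi fun i => Measure.pi fun j => complexGaussian 0 (v i j) := by
  rw [pi_pi_map (fun i j z => (c i j : ℂ) * z) (fun i j => by fun_prop)]
  have (i : Fin a) (j : Fin b) :
      (complexGaussian 0 1).map (fun z => (c i j : ℂ) * z) = complexGaussian 0 (v i j) := by
    rw [map_mul_complexGaussian, mul_one, ← hv, Real.toNNReal_coe]
  simp_rw [this]

section Laws

variable {n m : ℕ} {p g : Fin m → ℝ}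

theorem eigenLaw_eq_pi (g : Fin m → ℝ) (X : Matrix (Fin n) (Fin m) ℂ) :
    eigenLaw g X = Measure.pi fun i => Measure.pi fun j =>
      complexGaussian ((√(g j) : ℂ) * X i j) 1 := by
  rw [eigenLaw, pi_pi_map (fun i j z => (√(g j) : ℂ) * X i j + z) (fun i j => by fun_prop)]
  simp_rw [map_const_add_complexGaussian]

instance (g : Fin m → ℝ) (X : Matrix (Fin n) (Fin m) ℂ) :
    IsProbabilityMeasure (eigenLaw g X) := by
  rw [eigenLaw_eq_pi]; infer_instance

instance : IsProbabilityMeasure (auxLaw n p g) := by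
  unfold auxLaw; infer_instance

theorem auxLaw_eq_map (hp : ∀ j, 0 ≤ p j) (hg : ∀ j, 0 ≤ g j) :
    auxLaw n p g = (stdNoise n m).map fun Z i j => (√(1 + g j * p j) : ℂ) * Z i j := by
  rw [map_scale_stdNoise (fun _ j => √(1 + g j * p j)) (fun _ j => (1 + g j * p j).toNNReal)]
  · rfl
  · intro i j
    have := mul_nonneg (hg j) (hp j)
    rw [Real.coe_toNNReal _ (by positivity), Real.sq_sqrt (by positivity)]

/-- The auxiliary output law, column by column. -/
theorem auxLaw_eq_map_transpose (hp : ∀ j, 0 ≤ p j) (hg : ∀ j, 0 ≤ g j) :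
    auxLaw n p g = (Measure.pi fun j => Measure.pi fun _ : Fin n =>
      complexGaussian 0 (1 + g j * p j).toNNReal).map (fun Z i j => Z j i) := by
  rw [auxLaw_eq_map hp hg, ← map_scale_stdNoise (fun j (_ : Fin n) => √(1 + g j * p j)),
    ← map_transpose_stdNoise m n, Measure.map_map (by fun_prop) (by fun_prop),
    Measure.map_map (by fun_prop) (by fun_prop)]
  · rfl
  · intro j i
    have := mul_nonneg (hg j) (hp j)
    rw [Real.coe_toNNReal _ (by positivity), Real.sq_sqrt (by positivity)]

/-- The output law of the eigen-channels, column by column. -/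
theorem eigenLaw_eq_map_transpose (g : Fin m → ℝ) (X : Matrix (Fin n) (Fin m) ℂ) :
    eigenLaw g X = (stdNoise m n).map (fun W i j => (√(g j) : ℂ) * X i j + W j i) := by
  rw [eigenLaw, ← map_transpose_stdNoise m n, Measure.map_map (by fun_prop) (by fun_prop)]
  rfl

/-! ### The lower bound on `κ` -/

/-- A product of outputs of random inputs is the output of the product input. -/
theorem pi_map_prod_eq {δ : Type*} [Fintype δ] {α β : Type*} [MeasurableSpace α]
    [MeasurableSpace β] {μ : δ → Measure α} {ν : δ → Measure β} [∀ j, IsProbabilityMeasure (μ j)]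
    [∀ j, IsProbabilityMeasure (ν j)] {f : δ → α × β → β} (hf : ∀ j, Measurable (f j)) :
    (Measure.pi fun j => ((μ j).prod (ν j)).map (f j)) =
      ((Measure.pi μ).prod (Measure.pi ν)).map (fun y j => f j (y.1 j, y.2 j)) := by
  have (j : δ) : IsProbabilityMeasure (((μ j).prod (ν j)).map (f j)) :=
    Measure.isProbabilityMeasure_map (hf j).aemeasurable
  rw [← Measure.pi_map_pi (fun j => (hf j).aemeasurable),
    ← (measurePreserving_arrowProdEquivProdArrow α β δ μ ν).map_eq,
    Measure.map_map (by fun_prop) (MeasurableEquiv.measurable _)]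
  rfl

/-- The constant in the lower bound on `κ`. -/
def kappaConst (p g : Fin m → ℝ) : ℝ := ∏ j, (2 * Real.exp 1 * √(1 + g j * p j))

theorem kappaConst_pos (hp : ∀ j, 0 ≤ p j) (hg : ∀ j, 0 ≤ g j) : 0 < kappaConst p g := by
  refine Finset.prod_pos fun j _ => ?_
  have := mul_nonneg (hg j) (hp j)
  positivity

/-- Averaging the constraints on a test over independent symmetric inputs on the spheres of the
columns bounds its acceptance probability under the auxiliary law from below. -/
theorem le_integral_auxLaw (hn : 0 < n) (hp : ∀ j, 0 ≤ p j) (hg : ∀ j, 0 ≤ g j) {τ : ℝ}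
    {φ : (Fin n → Fin m → ℂ) → ℝ} (hφ : IsTest φ)
    (hτ : ∀ X ∈ inputSet n p, τ ≤ ∫ y, φ y ∂(eigenLaw g X)) :
    τ ≤ kappaConst p g * ∫ y, φ y ∂(auxLaw n p g) := by
  choose π hπprob hπsphere hπle using fun j => exists_sphere_mixture hn (hp j) (hg j)
  have hn' : (n : ℝ) ≠ 0 := by positivity
  have hFm : ∀ j, Measurable fun (y : (Fin n → ℂ) × (Fin n → ℂ)) i =>
      (√(g j) : ℂ) * y.1 i + y.2 i := fun j => by fun_prop
  have (j : Fin m) : IsProbabilityMeasure (((π j).prod (Measure.pi fun _ : Fin n =>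
      complexGaussian 0 1)).map fun y i => (√(g j) : ℂ) * y.1 i + y.2 i) :=
    Measure.isProbabilityMeasure_map (hFm j).aemeasurable
  have hCpos : ∀ j, 0 < 2 * Real.exp 1 * √(1 + g j * p j) := fun j => by
    have := mul_nonneg (hg j) (hp j)
    positivity
  have hle := pi_le_smul_pi _ _ _ (fun j => (ENNReal.ofReal_pos.2 (hCpos j)).ne')
    (fun j => ENNReal.ofReal_ne_top) hπle
  rw [pi_map_prod_eq hFm, ← ENNReal.ofReal_prod_of_nonneg fun j _ => (hCpos j).le] at hle
  set Q := ((Measure.pi π).prod (Measure.pi fun _ : Fin m => Measure.pi fun _ : Fin n =>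
    complexGaussian 0 1)).map fun y j i => (√(g j) : ℂ) * y.1 j i + y.2 j i with hQ
  set ν := Measure.pi fun j => Measure.pi fun _ : Fin n =>
    complexGaussian 0 (1 + g j * p j).toNNReal with hν
  have hQm : Measurable fun (y : (Fin m → Fin n → ℂ) × (Fin m → Fin n → ℂ)) j i =>
      (√(g j) : ℂ) * y.1 j i + y.2 j i := by fun_prop
  have hQprob : IsProbabilityMeasure Q := Measure.isProbabilityMeasure_map hQm.aemeasurable
  have hswap : Measurable fun (Z : Fin m → Fin n → ℂ) i j => Z j i := by fun_prop
  have hφ' : IsTest fun Z : Fin m → Fin n → ℂ => φ (fun i j => Z j i) :=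
    ⟨hφ.1.comp hswap, fun y => hφ.2 _⟩
  have h1 : ∫ Z, φ (fun i j => Z j i) ∂Q ≤
      kappaConst p g * ∫ Z, φ (fun i j => Z j i) ∂ν := by
    have h2 : ∫ Z, φ (fun i j => Z j i) ∂Q ≤
        ∫ Z, φ (fun i j => Z j i) ∂(ENNReal.ofReal (kappaConst p g) • ν) := by
      refine integral_mono_measure hle (.of_forall fun Z => (hφ.2 _).1) ?_
      exact (hφ'.integrable ν).smul_measure ENNReal.ofReal_ne_top
    rwa [integral_smul_measure, ENNReal.toReal_ofReal (kappaConst_pos hp hg).le,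
      smul_eq_mul] at h2
  have h3 : ∫ y, φ y ∂(auxLaw n p g) = ∫ Z, φ (fun i j => Z j i) ∂ν := by
    rw [auxLaw_eq_map_transpose hp hg,
      integral_map hswap.aemeasurable hφ.1.aestronglyMeasurable]
  rw [h3]
  refine le_trans ?_ h1
  have hφm : Measurable fun (y : (Fin m → Fin n → ℂ) × (Fin m → Fin n → ℂ)) =>
      φ (fun i j => (√(g j) : ℂ) * y.1 j i + y.2 j i) := hφ.1.comp (hswap.comp hQm)
  have hφ'' : IsTest fun (y : (Fin m → Fin n → ℂ) × (Fin m → Fin n → ℂ)) =>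
      φ (fun i j => (√(g j) : ℂ) * y.1 j i + y.2 j i) := ⟨hφm, fun y => hφ.2 _⟩
  rw [hQ, integral_map hQm.aemeasurable hφ'.1.aestronglyMeasurable,
    integral_prod _ (hφ''.integrable _)]
  have hae : ∀ᵐ x ∂(Measure.pi π), τ ≤ ∫ W, φ (fun i j => (√(g j) : ℂ) * x j i + W j i)
      ∂(stdNoise m n) := by
    have : ∀ᵐ x ∂(Measure.pi π), ∀ j, ∑ i, ‖x j i‖ ^ 2 = n * p j := by
      rw [ae_all_iff]
      intro j
      exact (Measure.quasiMeasurePreserving_eval π j).ae (hπsphere j)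
    filter_upwards [this] with x hx
    have hX := hτ (Matrix.of fun i j => x j i) (fun j => by
      simp only [power, Matrix.of_apply, hx j]; field_simp)
    rw [eigenLaw_eq_map_transpose] at hX
    simp only [Matrix.of_apply] at hX
    have hxm : Measurable fun (W : Fin m → Fin n → ℂ) (i : Fin n) (j : Fin m) =>
        (√(g j) : ℂ) * x j i + W j i := by fun_prop
    rwa [integral_map hxm.aemeasurable hφ.1.aestronglyMeasurable] at hX
  have hmono := integral_mono_ae (integrable_const τ)
    ((hφ''.integrable ((Measure.pi π).prod (stdNoise m n))).integral_prod_left) hae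
  rw [integral_const, probReal_univ, one_smul] at hmono
  exact hmono

theorem div_le_kappa (hn : 0 < n) (hp : ∀ j, 0 ≤ p j) (hg : ∀ j, 0 ≤ g j) {τ : ℝ} (hτ : τ ≤ 1) :
    τ / kappaConst p g ≤ kappa τ (inputSet n p) (eigenLaw g) (auxLaw n p g) := by
  refine le_csInf ⟨_, fun _ => 1, ⟨measurable_const, fun _ => ⟨zero_le_one, le_rfl⟩⟩,
    fun X _ => by simpa using hτ, rfl⟩ ?_
  rintro b ⟨φ, hφ, h, rfl⟩
  rw [div_le_iff₀' (kappaConst_pos hp hg)]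
  exact le_integral_auxLaw hn hp hg hφ h

end Laws

/-! ### The information density -/

/-- The real inner product of column `j` of two complex arrays. -/
def colInner {n m : ℕ} (w z : Fin n → Fin m → ℂ) (j : Fin m) : ℝ :=
  ∑ i, ((w i j).re * (z i j).re + (w i j).im * (z i j).im)

theorem realInner_eq_sum_colInner {n m : ℕ} (w z : Fin n → Fin m → ℂ) :
    realInner w z = ∑ j, colInner w z j :=
  Finset.sum_comm

theorem colInner_comm {n m : ℕ} (w z : Fin n → Fin m → ℂ) (j : Fin m) :
    colInner w z j = colInner z w j := by
  simp only [colInner]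
  exact Finset.sum_congr rfl fun i _ => by ring

theorem colInner_self {n m : ℕ} (w : Fin n → Fin m → ℂ) (j : Fin m) :
    colInner w w j = ∑ i, ‖w i j‖ ^ 2 := by
  simp only [colInner]
  refine Finset.sum_congr rfl fun i _ => ?_
  rw [Complex.sq_norm, Complex.normSq_apply]

theorem colInner_sub_smul {n m : ℕ} (w z u : Fin n → Fin m → ℂ) (a : Fin m → ℝ) (j : Fin m) :
    colInner w (fun i j => z i j - (a j : ℂ) * u i j) j = colInner w z j - a j * colInner w u j := by
  simp only [colInner]
  rw [Finset.mul_sum, ← Finset.sum_sub_distrib]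
  refine Finset.sum_congr rfl fun i _ => ?_
  simp
  ring

theorem colInner_sub_left {n m : ℕ} (w w' z : Fin n → Fin m → ℂ) (j : Fin m) :
    colInner (w - w') z j = colInner w z j - colInner w' z j := by
  simp only [colInner]
  rw [← Finset.sum_sub_distrib]
  refine Finset.sum_congr rfl fun i _ => ?_
  simp
  ring

theorem colInner_self_eq_zero {n m : ℕ} {u : Fin n → Fin m → ℂ} {j : Fin m}
    (h : colInner u u j = 0) (z : Fin n → Fin m → ℂ) : colInner u z j = 0 := by
  rw [colInner_self, Finset.sum_eq_zero_iff_of_nonneg fun i _ => by positivity] at h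
  refine Finset.sum_eq_zero fun i _ => ?_
  have : u i j = 0 := by simpa using h i (Finset.mem_univ i)
  simp [this]

/-- The Householder reflection of every column `j` of an array along column `j` of `u`. Where
that column vanishes the division by zero makes the reflection the identity. -/
def colReflection {n m : ℕ} (u : Fin n → Fin m → ℂ) :
    (Fin n → Fin m → ℂ) →L[ℝ] (Fin n → Fin m → ℂ) :=
  LinearMap.toContinuousLinearMap
    { toFun := fun z i j => z i j - ((2 * colInner u z j / colInner u u j : ℝ) : ℂ) * u i j
      map_add' := fun z z' => by
        have : ∀ j, colInner u (z + z') j = colInner u z j + colInner u z' j := fun j => by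
          simp only [colInner]
          rw [← Finset.sum_add_distrib]
          refine Finset.sum_congr rfl fun i _ => ?_
          simp
          ring
        ext i j
        simp only [Pi.add_apply, this]
        push_cast
        ring
      map_smul' := fun a z => by
        have : ∀ j, colInner u (a • z) j = a * colInner u z j := fun j => by
          simp only [colInner]
          rw [Finset.mul_sum]
          refine Finset.sum_congr rfl fun i _ => ?_
          simp
          ring
        ext i j
        simp only [Pi.smul_apply, this, RingHom.id_apply, Complex.real_smul]
        push_cast
        ring }

theorem colReflection_apply {n m : ℕ} (u z : Fin n → Fin m → ℂ) :
    colReflection u z = fun i j =>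
      z i j - ((2 * colInner u z j / colInner u u j : ℝ) : ℂ) * u i j := rfl

theorem colInner_colReflection {n m : ℕ} (u w z : Fin n → Fin m → ℂ) (j : Fin m) :
    colInner w (colReflection u z) j =
      colInner w z j - 2 * colInner u z j / colInner u u j * colInner w u j := by
  rw [colReflection_apply, colInner_sub_smul]

theorem colInner_colReflection_self {n m : ℕ} (u z : Fin n → Fin m → ℂ) (j : Fin m) :
    colInner (colReflection u z) (colReflection u z) j = colInner z z j := by
  rw [colInner_colReflection, colInner_comm _ z, colInner_comm _ u, colInner_colReflection,
    colInner_comm (colReflection u z) u, colInner_colReflection, colInner_comm z u]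
  by_cases h : colInner u u j = 0
  · rw [h]; simp
  · field_simp
    ring

theorem map_colReflection {n m : ℕ} (u : Fin n → Fin m → ℂ) :
    (stdNoise n m).map (colReflection u) = stdNoise n m := by
  refine map_stdNoise _ (colReflection u) (fun w z => ?_) (fun w => ?_)
  · rw [realInner_eq_sum_colInner, realInner_eq_sum_colInner]
    refine Finset.sum_congr rfl fun j _ => ?_
    rw [colInner_comm (colReflection u w), colInner_colReflection, colInner_colReflection,
      colInner_comm z w, colInner_comm w u, colInner_comm z u]
    ring
  · simp_rw [realInner_eq_sum_colInner, colInner_colReflection_self]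

/-- The common form of the information densities: a column-wise combination of the squared norm
of the noise and of its inner product with the input. -/
def quadStat {n m : ℕ} (a b c : Fin m → ℝ) (X Z : Fin n → Fin m → ℂ) : ℝ :=
  ∑ j, (n * a j - b j * colInner Z Z j + c j * colInner X Z j)

theorem measurable_colInner_right {n m : ℕ} (w : Fin n → Fin m → ℂ) (j : Fin m) :
    Measurable fun z => colInner w z j := by
  unfold colInner; fun_prop

theorem measurable_colInner_self {n m : ℕ} (j : Fin m) :
    Measurable fun z : Fin n → Fin m → ℂ => colInner z z j := by
  unfold colInner; fun_prop

theorem measurable_quadStat {n m : ℕ} (a b c : Fin m → ℝ) (X : Fin n → Fin m → ℂ) :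
    Measurable (quadStat a b c X) := by
  unfold quadStat
  refine Finset.measurable_sum _ fun j _ => ?_
  exact (measurable_const.sub ((measurable_colInner_self j).const_mul _)).add
    ((measurable_colInner_right X j).const_mul _)

/-- The law of `quadStat` depends on the input only through the norms of its columns. -/
theorem map_quadStat_congr {n m : ℕ} (a b c : Fin m → ℝ) {X X' : Fin n → Fin m → ℂ}
    (h : ∀ j, colInner X X j = colInner X' X' j) :
    (stdNoise n m).map (quadStat a b c X) = (stdNoise n m).map (quadStat a b c X') := by
  -- the reflection along `X - X'` swaps `X` and `X'`, whose columns have equal norms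
  conv_rhs => rw [← map_colReflection (X - X'), Measure.map_map (measurable_quadStat _ _ _ _)
    (ContinuousLinearMap.measurable _)]
  congr 1
  ext Z
  simp only [quadStat, Function.comp_apply, colInner_colReflection_self]
  refine Finset.sum_congr rfl fun j _ => ?_
  congr 2
  rw [colInner_colReflection, colInner_comm X' (X - X')]
  by_cases hN : colInner (X - X') (X - X') j = 0
  · have := colInner_self_eq_zero hN Z
    rw [colInner_sub_left] at this
    rw [hN, div_zero, zero_mul]
    linarith
  · have h1 : colInner (X - X') (X - X') j = -2 * colInner (X - X') X' j := by
      rw [colInner_sub_left, colInner_comm X, colInner_comm X', colInner_sub_left,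
        colInner_sub_left, h j, colInner_comm X' X]
      ring
    have h2 : colInner (X - X') X' j ≠ 0 := fun h0 => hN (by rw [h1, h0, mul_zero])
    rw [h1]
    have h3 : 2 * colInner (X - X') Z j / (-2 * colInner (X - X') X' j) *
        colInner (X - X') X' j = -colInner (X - X') Z j := by
      field_simp
    rw [h3, colInner_sub_left]
    ring

section Density

variable {n m : ℕ} {p g : Fin m → ℝ}

/-- The logarithm of the density of the output law of the eigen-channels. -/
def logDensity (p g : Fin m → ℝ) (X : Matrix (Fin n) (Fin m) ℂ) (Y : Fin n → Fin m → ℂ) : ℝ :=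
  ∑ i, ∑ j, (Real.log (1 + g j * p j) + ‖Y i j‖ ^ 2 / (1 + g j * p j) -
    ‖Y i j - (√(g j) : ℂ) * X i j‖ ^ 2)

theorem measurable_logDensity (X : Matrix (Fin n) (Fin m) ℂ) : Measurable (logDensity p g X) := by
  unfold logDensity; fun_prop

theorem one_add_pos (hp : ∀ j, 0 ≤ p j) (hg : ∀ j, 0 ≤ g j) (j : Fin m) : 0 < 1 + g j * p j := by
  have := mul_nonneg (hg j) (hp j)
  positivity

theorem eigenLaw_eq_withDensity (hp : ∀ j, 0 ≤ p j) (hg : ∀ j, 0 ≤ g j)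
    (X : Matrix (Fin n) (Fin m) ℂ) :
    eigenLaw g X = (auxLaw n p g).withDensity fun Y =>
      ENNReal.ofReal (Real.exp (logDensity p g X Y)) := by
  have hv := one_add_pos hp hg
  have hv0 : ∀ j, (1 + g j * p j).toNNReal ≠ 0 := fun j => by simpa using hv j
  set f : Fin n → Fin m → ℂ → ℝ≥0∞ := fun i j z => ENNReal.ofReal
    (((1 + g j * p j).toNNReal : ℝ) / (1 : ℝ≥0) * Real.exp (‖z - 0‖ ^ 2 /
      ((1 + g j * p j).toNNReal : ℝ) - ‖z - (√(g j) : ℂ) * X i j‖ ^ 2 / (1 : ℝ≥0))) with hf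
  have hfm : ∀ i j, Measurable (f i j) := fun i j => by fun_prop
  have h1 : ∀ i j, complexGaussian ((√(g j) : ℂ) * X i j) 1 =
      (complexGaussian 0 (1 + g j * p j).toNNReal).withDensity (f i j) := fun i j =>
    complexGaussian_eq_withDensity_complexGaussian _ 0 one_ne_zero (hv0 j)
  have h1p (i : Fin n) (j : Fin m) : IsProbabilityMeasure
      ((complexGaussian 0 (1 + g j * p j).toNNReal).withDensity (f i j)) := by
    rw [← h1]; infer_instance
  have h2 : ∀ i, (Measure.pi fun j => complexGaussian ((√(g j) : ℂ) * X i j) 1) =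
      (Measure.pi fun j => complexGaussian 0 (1 + g j * p j).toNNReal).withDensity
        fun y => ∏ j, f i j (y j) := fun i => by
    simp_rw [h1 i]
    rw [pi_withDensity _ (hfm i)]
  have h2p (i : Fin n) : IsProbabilityMeasure
      ((Measure.pi fun j => complexGaussian 0 (1 + g j * p j).toNNReal).withDensity
        fun y => ∏ j, f i j (y j)) := by
    rw [← h2]; infer_instance
  rw [eigenLaw_eq_pi]
  simp_rw [h2]
  rw [pi_withDensity (fun _ : Fin n => Measure.pi fun j =>
      complexGaussian 0 (1 + g j * p j).toNNReal) (f := fun i y => ∏ j, f i j (y j))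
    (fun i => Finset.measurable_prod _ fun j _ => (hfm i j).comp (measurable_pi_apply j))]
  change (auxLaw n p g).withDensity _ = _
  congr 1
  ext Y
  have h3 : ∀ i j, f i j (Y i j) = ENNReal.ofReal (Real.exp (Real.log (1 + g j * p j) +
      ‖Y i j‖ ^ 2 / (1 + g j * p j) - ‖Y i j - (√(g j) : ℂ) * X i j‖ ^ 2)) := by
    intro i j
    simp only [hf, Real.coe_toNNReal _ (hv j).le, NNReal.coe_one, div_one, sub_zero]
    rw [add_sub_assoc, Real.exp_add, Real.exp_log (hv j)]
  simp_rw [h3, ← ENNReal.ofReal_prod_of_nonneg fun _ _ => (Real.exp_pos _).le]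
  rw [← ENNReal.ofReal_prod_of_nonneg fun i _ => Finset.prod_nonneg fun j _ => (Real.exp_pos _).le]
  simp_rw [← Real.exp_sum]
  rfl

theorem eigenLaw_absolutelyContinuous (hp : ∀ j, 0 ≤ p j) (hg : ∀ j, 0 ≤ g j)
    (X : Matrix (Fin n) (Fin m) ℂ) : eigenLaw g X ≪ auxLaw n p g := by
  rw [eigenLaw_eq_withDensity hp hg]
  exact withDensity_absolutelyContinuous _ _

theorem auxLaw_absolutelyContinuous (hp : ∀ j, 0 ≤ p j) (hg : ∀ j, 0 ≤ g j)
    (X : Matrix (Fin n) (Fin m) ℂ) : auxLaw n p g ≪ eigenLaw g X := by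
  rw [eigenLaw_eq_withDensity hp hg]
  exact withDensity_absolutelyContinuous'
    (measurable_logDensity X).exp.ennreal_ofReal.aemeasurable
    (.of_forall fun Y => by simpa using Real.exp_pos _)

theorem infoDensity_ae_eq (hp : ∀ j, 0 ≤ p j) (hg : ∀ j, 0 ≤ g j)
    (X : Matrix (Fin n) (Fin m) ℂ) :
    infoDensity p g X =ᵐ[auxLaw n p g] logDensity p g X := by
  have h := Measure.rnDeriv_withDensity (auxLaw n p g)
    (measurable_logDensity (p := p) (g := g) X).exp.ennreal_ofReal
  rw [← eigenLaw_eq_withDensity hp hg] at h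
  filter_upwards [h] with Y hY
  rw [infoDensity, llr, hY, ENNReal.toReal_ofReal (Real.exp_pos _).le, Real.log_exp]

theorem sum_norm_sq_of_mem_inputSet (hn : 0 < n) {X : Matrix (Fin n) (Fin m) ℂ}
    (hX : X ∈ inputSet n p) (j : Fin m) : ∑ i, ‖X i j‖ ^ 2 = n * p j := by
  have h := hX j
  have hn' : (n : ℝ) ≠ 0 := by positivity
  rw [← h, power]
  field_simp

/-- The input that spends the power `p j` evenly on the channel uses. -/
def constInput (n : ℕ) (p : Fin m → ℝ) : Matrix (Fin n) (Fin m) ℂ :=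
  Matrix.of fun _ j => (√(p j) : ℂ)

theorem constInput_mem (hn : 0 < n) (hp : ∀ j, 0 ≤ p j) : constInput n p ∈ inputSet n p := by
  intro j
  have hn' : (n : ℝ) ≠ 0 := by positivity
  simp only [power, constInput, Matrix.of_apply, Complex.norm_real, Real.norm_eq_abs, sq_abs,
    Real.sq_sqrt (hp j)]
  simp [hn']

theorem colInner_eq_of_mem_inputSet (hn : 0 < n) {X X' : Matrix (Fin n) (Fin m) ℂ}
    (hX : X ∈ inputSet n p) (hX' : X' ∈ inputSet n p) (j : Fin m) :
    colInner X X j = colInner X' X' j :=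
  (colInner_self X j).trans ((sum_norm_sq_of_mem_inputSet hn hX j).trans
    ((sum_norm_sq_of_mem_inputSet hn hX' j).symm.trans (colInner_self X' j).symm))

/-- On the inputs of given column norms the terms `‖X i j‖ ^ 2 - q j` sum to zero, so that the
entrywise identity need only hold up to multiples of them. -/
theorem sum_sum_eq_quadStat (a b c : Fin m → ℝ) (X Z : Fin n → Fin m → ℂ) (k : Fin m → ℝ)
    {q : Fin m → ℝ} (hX : ∀ j, ∑ i, ‖X i j‖ ^ 2 = n * q j) :
    ∑ i, ∑ j, (a j - k j * (‖X i j‖ ^ 2 - q j) - b j * ‖Z i j‖ ^ 2 +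
      c j * ((X i j).re * (Z i j).re + (X i j).im * (Z i j).im)) = quadStat a b c X Z := by
  rw [Finset.sum_comm, quadStat]
  refine Finset.sum_congr rfl fun j _ => ?_
  rw [Finset.sum_add_distrib, Finset.sum_sub_distrib, Finset.sum_sub_distrib, ← Finset.mul_sum,
    ← Finset.mul_sum, ← Finset.mul_sum, Finset.sum_sub_distrib, hX j, colInner_self, colInner]
  simp

/-- The law of the information density under the auxiliary output law. -/
theorem map_infoDensity_auxLaw (hn : 0 < n) (hp : ∀ j, 0 ≤ p j) (hg : ∀ j, 0 ≤ g j)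
    {X : Matrix (Fin n) (Fin m) ℂ} (hX : X ∈ inputSet n p) :
    (auxLaw n p g).map (infoDensity p g X) = (stdNoise n m).map (Gn p g) := by
  have hv := one_add_pos hp hg
  rw [Measure.map_congr (infoDensity_ae_eq hp hg X), auxLaw_eq_map hp hg,
    Measure.map_map (measurable_logDensity X) (by fun_prop)]
  let a : Fin m → ℝ := fun j => Real.log (1 + g j * p j) - g j * p j
  let b : Fin m → ℝ := fun j => g j * p j
  let c : Fin m → ℝ := fun j => 2 * (√(1 + g j * p j) * √(g j))
  have h1 : (logDensity p g X ∘ fun (Z : Fin n → Fin m → ℂ) i j =>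
      (√(1 + g j * p j) : ℂ) * Z i j) = quadStat a b c X := by
    ext Z
    rw [← sum_sum_eq_quadStat a b c X Z g (sum_norm_sq_of_mem_inputSet hn hX)]
    simp only [Function.comp_apply, logDensity, a, b, c]
    refine Finset.sum_congr rfl fun i _ => Finset.sum_congr rfl fun j _ => ?_
    have e1 := Real.sq_sqrt (hv j).le
    have e2 := Real.sq_sqrt (hg j)
    have e3 : ‖(√(1 + g j * p j) : ℂ) * Z i j‖ ^ 2 / (1 + g j * p j) = ‖Z i j‖ ^ 2 := by
      rw [norm_mul, mul_pow, Complex.norm_real, Real.norm_eq_abs, sq_abs, e1]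
      have := (hv j).ne'
      field_simp
    rw [e3]
    simp only [Complex.sq_norm, Complex.normSq_apply, Complex.sub_re, Complex.sub_im,
      Complex.mul_re, Complex.mul_im, Complex.ofReal_re, Complex.ofReal_im]
    linear_combination (-(Z i j).re ^ 2 - (Z i j).im ^ 2) * e1 +
      (-(X i j).re ^ 2 - (X i j).im ^ 2) * e2
  have h2 : Gn p g = quadStat (n := n) a b c (constInput n p) := by
    ext Z
    rw [← sum_sum_eq_quadStat a b c (constInput n p) Z g
      (sum_norm_sq_of_mem_inputSet hn (constInput_mem hn hp))]
    simp only [Gn, a, b, c, constInput, Matrix.of_apply]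
    refine Finset.sum_congr rfl fun i _ => Finset.sum_congr rfl fun j _ => ?_
    have e1 := Real.sq_sqrt (hv j).le
    have e2 := Real.sq_sqrt (hg j)
    have e4 := Real.sq_sqrt (hp j)
    rw [Real.sqrt_mul (hg j)]
    simp only [Complex.sq_norm, Complex.normSq_apply, Complex.sub_re, Complex.sub_im,
      Complex.mul_re, Complex.mul_im, Complex.ofReal_re, Complex.ofReal_im]
    have e5 : (√(g j) * √(p j)) ^ 2 = g j * p j := by rw [mul_pow, e2, e4]
    linear_combination (-(Z i j).re ^ 2 - (Z i j).im ^ 2) * e5 - e1 + g j * e4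
  rw [h1, h2]
  exact map_quadStat_congr a b c (colInner_eq_of_mem_inputSet hn hX (constInput_mem hn hp))

/-- The law of the information density under the output law of the eigen-channels. -/
theorem map_infoDensity_eigenLaw (hn : 0 < n) (hp : ∀ j, 0 ≤ p j) (hg : ∀ j, 0 ≤ g j)
    {X : Matrix (Fin n) (Fin m) ℂ} (hX : X ∈ inputSet n p) :
    (eigenLaw g X).map (infoDensity p g X) = (stdNoise n m).map (Hn p g) := by
  have hv := one_add_pos hp hg
  rw [Measure.map_congr ((eigenLaw_absolutelyContinuous hp hg X).ae_eq
    (infoDensity_ae_eq hp hg X)), eigenLaw,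
    Measure.map_map (measurable_logDensity X) (by fun_prop)]
  let a : Fin m → ℝ := fun j => Real.log (1 + g j * p j) + g j * p j / (1 + g j * p j)
  let b : Fin m → ℝ := fun j => g j * p j / (1 + g j * p j)
  let c : Fin m → ℝ := fun j => 2 * √(g j) / (1 + g j * p j)
  let k : Fin m → ℝ := fun j => -(g j / (1 + g j * p j))
  have h1 : (logDensity p g X ∘ fun (Z : Fin n → Fin m → ℂ) i j =>
      (√(g j) : ℂ) * X i j + Z i j) = quadStat a b c X := by
    ext Z
    rw [← sum_sum_eq_quadStat a b c X Z k (sum_norm_sq_of_mem_inputSet hn hX)]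
    simp only [Function.comp_apply, logDensity, a, b, c, k]
    refine Finset.sum_congr rfl fun i _ => Finset.sum_congr rfl fun j _ => ?_
    have e2 := Real.sq_sqrt (hg j)
    have hvj := (hv j).ne'
    rw [add_sub_cancel_left]
    simp only [Complex.sq_norm, Complex.normSq_apply, Complex.add_re, Complex.add_im,
      Complex.mul_re, Complex.mul_im, Complex.ofReal_re, Complex.ofReal_im]
    field_simp
    linear_combination ((X i j).re ^ 2 + (X i j).im ^ 2) * e2
  have h2 : Hn p g = quadStat (n := n) a b c (constInput n p) := by
    ext Z
    rw [← sum_sum_eq_quadStat a b c (constInput n p) Z k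
      (sum_norm_sq_of_mem_inputSet hn (constInput_mem hn hp))]
    simp only [Hn, a, b, c, k, constInput, Matrix.of_apply]
    refine Finset.sum_congr rfl fun i _ => Finset.sum_congr rfl fun j _ => ?_
    have e2 := Real.sq_sqrt (hg j)
    have e4 := Real.sq_sqrt (hp j)
    have hvj := (hv j).ne'
    rw [Real.sqrt_mul (hg j)]
    have e5 : (√(g j) * √(p j)) ^ 2 = g j * p j := by rw [mul_pow, e2, e4]
    push_cast
    simp only [Complex.sq_norm, Complex.normSq_apply, Complex.sub_re, Complex.sub_im,
      Complex.mul_re, Complex.mul_im, Complex.ofReal_re, Complex.ofReal_im, Complex.one_re,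
      Complex.one_im]
    field_simp
    linear_combination (-(Z i j).re ^ 2 - (Z i j).im ^ 2) * e5 - g j * e4
  rw [h1, h2]
  exact map_quadStat_congr a b c (colInner_eq_of_mem_inputSet hn hX (constInput_mem hn hp))

/-! ### The threshold -/

theorem measurable_Gn : Measurable (Gn (n := n) p g) := by unfold Gn; fun_prop

theorem measurable_Hn : Measurable (Hn (n := n) p g) := by unfold Hn; fun_prop

/-- A circle is a null set of a nondegenerate complex Gaussian law. -/
theorem complexGaussian_circle_null {s v l : ℝ} (hs : 0 < s) (hv : 0 < v) (c : ℝ) :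
    complexGaussian 0 1 {z | l - ‖(√s : ℂ) * z - 1‖ ^ 2 / v = c} = 0 := by
  have hac : complexGaussian 0 1 ≪ volume := by
    rw [complexGaussian_eq_withDensity 0 one_ne_zero]
    exact withDensity_absolutelyContinuous _ _
  refine hac (measure_mono_null (fun z hz => ?_)
    (Measure.addHaar_sphere volume ((√s : ℂ)⁻¹) (√((l - c) * v) / √s)))
  have hs' : 0 < √s := Real.sqrt_pos.2 hs
  have hsc : (√s : ℂ) ≠ 0 := by exact_mod_cast hs'.ne'
  have h1 : ‖(√s : ℂ) * z - 1‖ ^ 2 = (l - c) * v := by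
    have : l - ‖(√s : ℂ) * z - 1‖ ^ 2 / v = c := hz
    field_simp at this
    linarith
  have h2 : (√s : ℂ) * z - 1 = √s * (z - (√s : ℂ)⁻¹) := by field_simp
  rw [Metric.mem_sphere, dist_eq_norm, eq_div_iff hs'.ne', ← h1, Real.sqrt_sq (norm_nonneg _), h2,
    norm_mul, Complex.norm_real, Real.norm_eq_abs, abs_of_pos hs', mul_comm]

/-- `Hn` has no atoms, since the entries of an active column contribute a term without atoms. -/
theorem exists_probH_eq (hn : 0 < n) (hp : ∀ j, 0 ≤ p j) (hg : ∀ j, 0 ≤ g j) {j₀ : Fin m}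
    (hj₀ : 0 < g j₀ * p j₀) {a : ℝ} (h0 : 0 < a) (h1 : a < 1) : ∃ γ, probH n p g γ = a := by
  have hv := one_add_pos hp hg
  refine exists_real_tail_eq (stdNoise n m) measurable_Hn (fun c => ?_) h0 h1
  let f : Fin m → ℂ → ℝ := fun j z => Real.log (1 + g j * p j) + 1 -
    ‖(√(g j * p j) : ℂ) * z - 1‖ ^ 2 / (1 + g j * p j)
  have hf : ∀ j, Measurable (f j) := fun j => by fun_prop
  have hrow : ∀ c, Measure.pi (fun _ : Fin m => complexGaussian 0 1)
      {x | ∑ j, f j (x j) = c} = 0 :=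
    pi_sum_eq_null _ f hf j₀ fun c => complexGaussian_circle_null hj₀ (hv j₀) c
  exact pi_sum_eq_null (fun _ : Fin n => Measure.pi fun _ : Fin m => complexGaussian 0 1)
    (fun _ x => ∑ j, f j (x j))
    (fun _ => Finset.measurable_sum _ fun j _ => (hf j).comp (measurable_pi_apply j))
    ⟨0, hn⟩ hrow c

theorem eigenLaw_real_infoDensity (hn : 0 < n) (hp : ∀ j, 0 ≤ p j) (hg : ∀ j, 0 ≤ g j)
    {X : Matrix (Fin n) (Fin m) ℂ} (hX : X ∈ inputSet n p) (γ : ℝ) :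
    (eigenLaw g X).real {Y | γ ≤ infoDensity p g X Y} = probH n p g γ := by
  have h := map_infoDensity_eigenLaw hn hp hg hX
  have h1 := map_measureReal_apply (μ := eigenLaw g X)
    (measurable_llr (eigenLaw g X) (auxLaw n p g)) (measurableSet_Ici (a := γ))
  have h2 := map_measureReal_apply (μ := stdNoise n m)
    (measurable_Hn (p := p) (g := g)) (measurableSet_Ici (a := γ))
  exact h1.symm.trans ((congrArg (fun μ : Measure ℝ => μ.real (Set.Ici γ)) h).trans h2)

theorem auxLaw_real_infoDensity (hn : 0 < n) (hp : ∀ j, 0 ≤ p j) (hg : ∀ j, 0 ≤ g j)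
    {X : Matrix (Fin n) (Fin m) ℂ} (hX : X ∈ inputSet n p) (γ : ℝ) :
    (auxLaw n p g).real {Y | γ ≤ infoDensity p g X Y} = probG n p g γ := by
  have h := map_infoDensity_auxLaw hn hp hg hX
  have h1 := map_measureReal_apply (μ := auxLaw n p g)
    (measurable_llr (eigenLaw g X) (auxLaw n p g)) (measurableSet_Ici (a := γ))
  have h2 := map_measureReal_apply (μ := stdNoise n m)
    (measurable_Gn (p := p) (g := g)) (measurableSet_Ici (a := γ))
  exact h1.symm.trans ((congrArg (fun μ : Measure ℝ => μ.real (Set.Ici γ)) h).trans h2)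

theorem beta_eq_probG (hn : 0 < n) (hp : ∀ j, 0 ≤ p j) (hg : ∀ j, 0 ≤ g j)
    {X : Matrix (Fin n) (Fin m) ℂ} (hX : X ∈ inputSet n p) {γ a : ℝ} (hγ : probH n p g γ = a) :
    beta a (eigenLaw g X) (auxLaw n p g) = probG n p g γ := by
  rw [← auxLaw_real_infoDensity hn hp hg hX]
  exact beta_eq_of_llr _ _ (eigenLaw_absolutelyContinuous hp hg X)
    (auxLaw_absolutelyContinuous hp hg X) ((eigenLaw_real_infoDensity hn hp hg hX γ).trans hγ)

theorem probG_pos (hn : 0 < n) (hp : ∀ j, 0 ≤ p j) (hg : ∀ j, 0 ≤ g j) {γ : ℝ}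
    (hγ : 0 < probH n p g γ) : 0 < probG n p g γ := by
  have hX := constInput_mem hn hp
  rw [← eigenLaw_real_infoDensity hn hp hg hX] at hγ
  rw [← auxLaw_real_infoDensity hn hp hg hX]
  refine measureReal_nonneg.lt_of_ne' fun h0 => hγ.ne' ?_
  rw [measureReal_eq_zero_iff] at h0 ⊢
  exact eigenLaw_absolutelyContinuous hp hg _ h0

end Density

/-! ### Greedy construction of codes -/

section Greedy

variable {ι α : Type*} [MeasurableSpace α]

theorem kappa_le {τ : ℝ} {F : Set ι} {K : ι → Measure α} {ν : Measure α} {φ : α → ℝ}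
    (hφ : IsTest φ) (h : ∀ x ∈ F, τ ≤ ∫ y, φ y ∂(K x)) : kappa τ F K ν ≤ ∫ y, φ y ∂ν := by
  refine csInf_le ⟨0, ?_⟩ ⟨φ, hφ, h, rfl⟩
  rintro b ⟨ψ, hψ, -, rfl⟩
  exact integral_nonneg fun y => (hψ.2 y).1

/-- `N` codewords `c i` in `F` with disjoint decoding sets `D i ⊆ A (c i)` of probability at least
`1 - ε`. -/
def IsPacking (K : ι → Measure α) (F : Set ι) (A : ι → Set α) (ε : ℝ) (N : ℕ) (c : ℕ → ι)
    (D : ℕ → Set α) : Prop :=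
  (∀ i < N, c i ∈ F ∧ MeasurableSet (D i) ∧ D i ⊆ A (c i) ∧ 1 - ε ≤ (K (c i)).real (D i)) ∧
    ∀ i < N, ∀ j < i, Disjoint (D i) (D j)

/-- A packing that no codeword extends has many codewords: the union of its decoding sets is a test
that meets the constraints of `κ`. -/
theorem kappa_le_of_maximal {K : ι → Measure α} [∀ x, IsProbabilityMeasure (K x)] {ν : Measure α}
    [IsProbabilityMeasure ν] {F : Set ι} {A : ι → Set α} (hA : ∀ x, MeasurableSet (A x))
    {ε τ b : ℝ} (hK : ∀ x ∈ F, (K x).real (A x) = 1 - ε + τ) (hb : ∀ x ∈ F, ν.real (A x) = b)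
    {N : ℕ} {c : ℕ → ι} {D : ℕ → Set α} (h : IsPacking K F A ε N c D)
    (hmax : ¬ ∃ c' D', IsPacking K F A ε (N + 1) c' D') :
    (∀ x ∈ F, τ ≤ (K x).real (⋃ i ∈ Finset.range N, D i)) ∧ kappa τ F K ν ≤ N * b := by
  set U : Set α := ⋃ i ∈ Finset.range N, D i with hU
  have hUm : MeasurableSet U :=
    Finset.measurableSet_biUnion _ fun i hi => (h.1 i (Finset.mem_range.1 hi)).2.1
  have hcov : ∀ x ∈ F, τ ≤ (K x).real U := by
    intro x hx
    by_contra! hlt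
    refine hmax ⟨Function.update c N x, Function.update D N (A x \ U), fun i hi => ?_,
      fun i hi j hj => ?_⟩
    · rcases Nat.lt_succ_iff_lt_or_eq.1 hi with hi | rfl
      · simpa [Function.update_of_ne hi.ne] using h.1 i hi
      · simp only [Function.update_self]
        refine ⟨hx, (hA x).diff hUm, Set.sdiff_subset, ?_⟩
        have h1 : (K x).real (A x) ≤ (K x).real (A x \ U) + (K x).real U := by
          refine (measureReal_mono ?_).trans (measureReal_union_le _ _)
          rw [Set.sdiff_union_self]
          exact Set.subset_union_left
        rw [hK x hx] at h1
        linarith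
    · rcases Nat.lt_succ_iff_lt_or_eq.1 hi with hi | rfl
      · rw [Function.update_of_ne hi.ne, Function.update_of_ne (hj.trans hi).ne]
        exact h.2 i hi j hj
      · rw [Function.update_self, Function.update_of_ne hj.ne]
        refine Set.disjoint_left.2 fun y hy hyj => hy.2 ?_
        exact Set.mem_biUnion (Finset.mem_coe.2 (Finset.mem_range.2 hj)) hyj
  refine ⟨hcov, (kappa_le (isTest_indicator hUm) fun x hx => ?_).trans ?_⟩
  · rw [integral_indicator_one hUm]; exact hcov x hx
  · rw [integral_indicator_one hUm]
    calc ν.real U ≤ ∑ i ∈ Finset.range N, ν.real (D i) := measureReal_biUnion_finset_le _ _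
      _ ≤ ∑ i ∈ Finset.range N, b := Finset.sum_le_sum fun i hi => by
          obtain ⟨hF, -, hD, -⟩ := h.1 i (Finset.mem_range.1 hi)
          rw [← hb _ hF]
          exact measureReal_mono hD
      _ = N * b := by simp

/-- There is a packing of size at least `κ / b`: a maximal one, or any large one if the sizes are
unbounded. -/
theorem exists_packing {K : ι → Measure α} [∀ x, IsProbabilityMeasure (K x)] {ν : Measure α}
    [IsProbabilityMeasure ν] {F : Set ι} (hF : F.Nonempty) {A : ι → Set α}
    (hA : ∀ x, MeasurableSet (A x)) {ε τ b : ℝ} (hτ : 0 < τ) (hb0 : 0 < b)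
    (hK : ∀ x ∈ F, (K x).real (A x) = 1 - ε + τ) (hb : ∀ x ∈ F, ν.real (A x) = b) :
    ∃ (N : ℕ) (c : ℕ → ι) (D : ℕ → Set α), 0 < N ∧ kappa τ F K ν / b ≤ N ∧
      IsPacking K F A ε N c D := by
  obtain ⟨x₀, hx₀⟩ := hF
  by_cases hall : ∀ N, ∃ c D, IsPacking K F A ε N c D
  · obtain ⟨c, D, h⟩ := hall (⌈kappa τ F K ν / b⌉₊ + 1)
    refine ⟨_, c, D, Nat.succ_pos _, ?_, h⟩
    push_cast
    linarith [Nat.le_ceil (kappa τ F K ν / b)]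
  · have h0 : ∃ c D, IsPacking K F A ε 0 c D :=
      ⟨fun _ => x₀, fun _ => ∅, fun i hi => absurd hi (Nat.not_lt_zero i),
        fun i hi => absurd hi (Nat.not_lt_zero i)⟩
    obtain ⟨N, ⟨c, D, h⟩, hmax⟩ : ∃ N, (∃ c D, IsPacking K F A ε N c D) ∧
        ¬ ∃ c D, IsPacking K F A ε (N + 1) c D := by
      by_contra! hstep
      exact hall fun N => by
        induction N with
        | zero => exact h0
        | succ N ih => exact hstep N ih
    obtain ⟨hcov, hle⟩ := kappa_le_of_maximal (ν := ν) hA hK hb h hmax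
    refine ⟨N, c, D, Nat.pos_of_ne_zero ?_, (div_le_iff₀ hb0).2 hle, h⟩
    rintro rfl
    have := hcov x₀ hx₀
    simp at this
    linarith

/-- The `κβ` bound for codes over an abstract channel. -/
theorem exists_code {K : ι → Measure α} [∀ x, IsProbabilityMeasure (K x)] {ν : Measure α}
    [IsProbabilityMeasure ν] {F : Set ι} (hF : F.Nonempty) {A : ι → Set α}
    (hA : ∀ x, MeasurableSet (A x)) {ε τ b : ℝ} (hτ : 0 < τ) (hb0 : 0 < b)
    (hK : ∀ x ∈ F, (K x).real (A x) = 1 - ε + τ) (hb : ∀ x ∈ F, ν.real (A x) = b) :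
    ∃ (M : ℕ) (c : Fin M → ι) (dec : α → Fin M), 1 ≤ M ∧ kappa τ F K ν / b ≤ M ∧
      (∀ j, c j ∈ F) ∧ Measurable dec ∧ ∀ j, (K (c j)).real {y | dec y ≠ j} ≤ ε := by
  classical
  obtain ⟨N, c, D, hN, hκ, hpack, hdisj⟩ := exists_packing (ν := ν) hF hA hτ hb0 hK hb
  let dec : α → Fin N := fun y => if h : ∃ i : Fin N, y ∈ D i then h.choose else ⟨0, hN⟩
  have hdec : ∀ (j : Fin N) (y : α), y ∈ D j → dec y = j := by
    intro j y hy
    have h : ∃ i : Fin N, y ∈ D i := ⟨j, hy⟩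
    have hd : dec y = h.choose := dif_pos h
    rw [hd]
    by_contra hne
    rcases lt_or_gt_of_ne hne with hlt | hlt
    · exact Set.disjoint_left.1 (hdisj j j.2 _ hlt) hy h.choose_spec
    · exact Set.disjoint_left.1 (hdisj _ h.choose.2 j hlt) h.choose_spec hy
  have hdec0 : ∀ y, (¬ ∃ i : Fin N, y ∈ D i) → dec y = ⟨0, hN⟩ := fun y hy => dif_neg hy
  have hUm : MeasurableSet (⋃ i : Fin N, D i) := MeasurableSet.iUnion fun i => (hpack i i.2).2.1
  refine ⟨N, fun j => c j, dec, hN, hκ, fun j => (hpack j j.2).1, ?_, fun j => ?_⟩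
  · refine measurable_to_countable' fun j => ?_
    have : dec ⁻¹' {j} = D j ∪ (if j = ⟨0, hN⟩ then (⋃ i : Fin N, D i)ᶜ else ∅) := by
      ext y
      by_cases hy : ∃ i : Fin N, y ∈ D i
      · obtain ⟨i, hi⟩ := hy
        have hU : y ∈ ⋃ i : Fin N, D i := Set.mem_iUnion.2 ⟨i, hi⟩
        have h1 : y ∉ (if j = ⟨0, hN⟩ then (⋃ i : Fin N, D i)ᶜ else ∅ : Set α) := by
          split_ifs
          exacts [fun h => h hU, Set.notMem_empty y]
        rw [Set.mem_preimage, Set.mem_singleton_iff, hdec i y hi, Set.mem_union]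
        constructor
        · rintro rfl; exact Or.inl hi
        · rintro (h | h)
          · rw [← hdec i y hi, hdec j y h]
          · exact absurd h h1
      · have hU : y ∉ ⋃ i : Fin N, D i := fun h => hy (Set.mem_iUnion.1 h)
        have h1 : y ∉ D j := fun h => hy ⟨j, h⟩
        rw [Set.mem_preimage, Set.mem_singleton_iff, hdec0 y hy, Set.mem_union]
        split_ifs with hj
        · simp only [hj, true_iff]
          exact Or.inr hU
        · simp only [h1, Set.mem_empty_iff_false, or_self, iff_false]
          exact fun h => hj h.symm
    rw [this]
    refine (hpack j j.2).2.1.union ?_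
    split_ifs
    exacts [hUm.compl, MeasurableSet.empty]
  · obtain ⟨-, hDm, -, hD⟩ := hpack j j.2
    calc (K (c j)).real {y | dec y ≠ j} ≤ (K (c j)).real (D j)ᶜ :=
          measureReal_mono fun y hy hyD => hy (hdec j y hyD)
      _ = 1 - (K (c j)).real (D j) := probReal_compl_eq_one_sub hDm
      _ ≤ ε := by linarith

end Greedy

/-! ### Water-filling -/

theorem waterPower_nonneg (l g : ℝ) : 0 ≤ waterPower l g := by
  unfold waterPower
  split_ifs
  exacts [le_rfl, le_max_right _ _]

theorem waterPower_mono (g : ℝ) : Monotone fun l => waterPower l g := by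
  intro l l' h
  simp only [waterPower]
  split_ifs
  · exact le_rfl
  · gcongr

theorem continuous_waterPower (g : ℝ) : Continuous fun l => waterPower l g := by
  by_cases h : g = 0
  · simp [waterPower, h, continuous_const]
  · simp only [waterPower, if_neg h]
    fun_prop

/-- The power on an active channel is strictly increasing in the water level. -/
theorem waterPower_lt {l l' g : ℝ} (h : l < l') (hpos : 0 < waterPower l g) :
    waterPower l g < waterPower l' g := by
  unfold waterPower at *
  split_ifs at * with hg
  · exact absurd hpos (lt_irrefl 0)
  · have h1 : 0 < l - 1 / g := by
      by_contra! hc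
      rw [max_eq_right hc] at hpos
      exact lt_irrefl 0 hpos
    rw [max_eq_left h1.le]
    exact lt_max_of_lt_left (by linarith)

/-- Existence by the intermediate value theorem, uniqueness by strict monotonicity. -/
theorem existsUnique_isWaterLevel {m : ℕ} {g : Fin m → ℝ} (hg : ∀ j, 0 ≤ g j) {j₀ : Fin m}
    (hj₀ : 0 < g j₀) {P : ℝ} (hP : 0 < P) : ∃! l, IsWaterLevel g P l := by
  have hlt : ∀ l l', IsWaterLevel g P l → l < l' → ¬ IsWaterLevel g P l' := by
    intro l l' hl hll' hl'
    obtain ⟨j, -, hj⟩ : ∃ j ∈ Finset.univ, 0 < waterPower l (g j) := by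
      by_contra! hc
      have := Finset.sum_nonpos hc
      unfold IsWaterLevel at hl
      linarith
    have : ∑ j, waterPower l (g j) < ∑ j, waterPower l' (g j) :=
      Finset.sum_lt_sum (fun i _ => waterPower_mono (g i) hll'.le)
        ⟨j, Finset.mem_univ j, waterPower_lt hll' hj⟩
    unfold IsWaterLevel at hl hl'
    linarith
  have hcont : Continuous fun l => ∑ j, waterPower l (g j) :=
    continuous_finsetSum _ fun j _ => continuous_waterPower (g j)
  obtain ⟨l, hl⟩ : ∃ l, ∑ j, waterPower l (g j) = P := by
    refine mem_range_of_exists_le_of_exists_ge hcont ⟨0, ?_⟩ ⟨P + 1 / g j₀, ?_⟩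
    · refine (Finset.sum_nonpos fun j _ => ?_).trans hP.le
      unfold waterPower
      split_ifs
      · exact le_rfl
      · have : 0 ≤ 1 / g j := one_div_nonneg.2 (hg j)
        exact max_le (by linarith) le_rfl
    · refine le_trans ?_ (Finset.single_le_sum (fun j _ => waterPower_nonneg _ _)
        (Finset.mem_univ j₀))
      rw [waterPower, if_neg hj₀.ne']
      exact le_max_of_le_left (by linarith)
  refine ⟨l, hl, fun l' hl' => ?_⟩
  rcases lt_trichotomy l' l with h | h | h
  · exact absurd hl (hlt l' l hl' h)
  · exact h
  · exact absurd hl' (hlt l l' hl h)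

theorem exists_mul_waterFill_pos {m : ℕ} {g : Fin m → ℝ} (hg : ∀ j, 0 ≤ g j) {P l : ℝ} (hP : 0 < P)
    (hl : IsWaterLevel g P l) : ∃ j, 0 < g j * waterFill g l j := by
  obtain ⟨j, -, hj⟩ : ∃ j ∈ Finset.univ, 0 < waterPower l (g j) := by
    by_contra! hc
    have := Finset.sum_nonpos hc
    unfold IsWaterLevel at hl
    linarith
  refine ⟨j, mul_pos ((hg j).lt_of_ne' fun h => ?_) hj⟩
  simp [waterPower, h] at hj

/-! ### Reduction of the matrix channel to its eigen-channels -/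

section Reduction

variable {n t r : ℕ}

/-- The index of the eigenvector of `Hᴴ H` for the eigenvalue `gains H j`. -/
def gainIndex (t r : ℕ) (j : Fin (min t r)) : Fin r :=
  Fintype.equivOfCardEq (Fintype.card_fin _)
    (⟨j, by rw [Fintype.card_fin]; exact lt_of_lt_of_le j.2 (min_le_right t r)⟩ :
      Fin (Fintype.card (Fin r)))

theorem gainIndex_injective : Function.Injective (gainIndex t r) := by
  intro i j h
  have := (Equiv.injective _) h
  simpa [Fin.ext_iff] using this

theorem gains_eq_eigenvalues (H : Matrix (Fin t) (Fin r) ℂ) (j : Fin (min t r)) :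
    gains H j = (Matrix.isHermitian_conjTranspose_mul_self H).eigenvalues (gainIndex t r j) := by
  simp [gains, Matrix.IsHermitian.eigenvalues, gainIndex]

open scoped ComplexOrder in
theorem gains_nonneg (H : Matrix (Fin t) (Fin r) ℂ) (j : Fin (min t r)) : 0 ≤ gains H j := by
  rw [gains_eq_eigenvalues]
  exact (Matrix.posSemidef_conjTranspose_mul_self H).eigenvalues_nonneg _

open scoped ComplexOrder in
theorem exists_gains_pos {H : Matrix (Fin t) (Fin r) ℂ} (hH : H ≠ 0) : ∃ j, 0 < gains H j := by
  have hA := Matrix.isHermitian_conjTranspose_mul_self H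
  obtain ⟨i, k, -⟩ : ∃ i k, H i k ≠ 0 := by
    by_contra! hc
    exact hH (Matrix.ext hc)
  have hmin : 0 < min t r := lt_min i.pos k.pos
  refine ⟨⟨0, hmin⟩, (gains_nonneg H _).lt_of_ne' fun h0 => hH ?_⟩
  rw [← Matrix.conjTranspose_mul_self_eq_zero, ← hA.eigenvalues_eq_zero_iff]
  ext l
  refine le_antisymm ?_ ((Matrix.posSemidef_conjTranspose_mul_self H).eigenvalues_nonneg l)
  rw [Pi.zero_apply, ← h0]
  exact hA.eigenvalues₀_antitone (Fin.mk_le_of_le_val (Nat.zero_le _))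

/-- The right singular vectors of `H` for its `min t r` largest singular values, as columns. -/
def rightSing (H : Matrix (Fin t) (Fin r) ℂ) : Matrix (Fin r) (Fin (min t r)) ℂ :=
  Matrix.of fun k j =>
    (Matrix.isHermitian_conjTranspose_mul_self H).eigenvectorBasis (gainIndex t r j) k

theorem rightSing_orthonormal (H : Matrix (Fin t) (Fin r) ℂ) :
    (rightSing H)ᴴ * rightSing H = 1 := by
  ext i j
  have h := orthonormal_iff_ite.1
    (Matrix.isHermitian_conjTranspose_mul_self H).eigenvectorBasis.orthonormal
    (gainIndex t r i) (gainIndex t r j)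
  rw [PiLp.inner_apply] at h
  rw [Matrix.mul_apply, Matrix.one_apply]
  simp only [gainIndex_injective.eq_iff] at h
  rw [← h]
  refine Finset.sum_congr rfl fun k _ => ?_
  simp [rightSing, mul_comm]

theorem conjTranspose_mul_self_mul_rightSing (H : Matrix (Fin t) (Fin r) ℂ) :
    Hᴴ * H * rightSing H = rightSing H * Matrix.diagonal fun j => (gains H j : ℂ) := by
  ext k j
  have h := congrFun ((Matrix.isHermitian_conjTranspose_mul_self H).mulVec_eigenvectorBasis
    (gainIndex t r j)) k
  rw [Matrix.mul_diagonal, gains_eq_eigenvalues]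
  simp only [Pi.smul_apply, Complex.real_smul] at h
  rw [mul_comm]
  exact h

/-- The left singular vectors of `H`, as columns. A column whose singular value vanishes is zero,
by the convention for division by zero. -/
def leftSing (H : Matrix (Fin t) (Fin r) ℂ) : Matrix (Fin t) (Fin (min t r)) ℂ :=
  H * rightSing H * Matrix.diagonal fun j => ((√(gains H j))⁻¹ : ℂ)

theorem gram_mul_rightSing (H : Matrix (Fin t) (Fin r) ℂ) :
    (H * rightSing H)ᴴ * (H * rightSing H) = Matrix.diagonal fun j => (gains H j : ℂ) := by
  rw [Matrix.conjTranspose_mul, Matrix.mul_assoc, ← Matrix.mul_assoc Hᴴ,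
    conjTranspose_mul_self_mul_rightSing, ← Matrix.mul_assoc, rightSing_orthonormal, Matrix.one_mul]

theorem conjTranspose_leftSing_mul (H : Matrix (Fin t) (Fin r) ℂ) :
    (leftSing H)ᴴ * (H * rightSing H) = Matrix.diagonal fun j => (√(gains H j) : ℂ) := by
  rw [leftSing, Matrix.conjTranspose_mul, Matrix.mul_assoc, gram_mul_rightSing,
    Matrix.diagonal_conjTranspose, Matrix.diagonal_mul_diagonal]
  congr 1
  ext j
  have h := Real.mul_self_sqrt (gains_nonneg H j)
  have : (gains H j : ℂ) = √(gains H j) * √(gains H j) := by exact_mod_cast h.symm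
  simp only [Pi.star_apply, star_inv₀, RCLike.star_def, Complex.conj_ofReal]
  by_cases h0 : (√(gains H j) : ℂ) = 0
  · simp [h0]
  · rw [this]; field_simp

/-- The nonzero left singular vectors are orthonormal. -/
theorem gram_leftSing (H : Matrix (Fin t) (Fin r) ℂ) :
    (leftSing H)ᴴ * leftSing H =
      Matrix.diagonal fun j => ((if gains H j = 0 then 0 else 1 : ℝ) : ℂ) := by
  have h : (leftSing H)ᴴ * leftSing H = (leftSing H)ᴴ * (H * rightSing H) *
      Matrix.diagonal fun j => ((√(gains H j))⁻¹ : ℂ) := by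
    rw [Matrix.mul_assoc]; rfl
  rw [h, conjTranspose_leftSing_mul, Matrix.diagonal_mul_diagonal]
  congr 1
  ext j
  by_cases h0 : gains H j = 0
  · simp [h0]
  · have h1 : (√(gains H j) : ℂ) ≠ 0 := by
      exact_mod_cast (Real.sqrt_pos.2 ((gains_nonneg H j).lt_of_ne' h0)).ne'
    simp [h0, h1]

theorem sum_norm_sq_eq_trace {a b : ℕ} (M : Matrix (Fin a) (Fin b) ℂ) :
    ((∑ i, ∑ k, ‖M i k‖ ^ 2 : ℝ) : ℂ) = (M * Mᴴ).trace := by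
  simp only [Matrix.trace, Matrix.diag_apply, Matrix.mul_apply, Matrix.conjTranspose_apply,
    RCLike.star_def, Complex.mul_conj']
  push_cast
  rfl

/-- Transmission along the left singular vectors does not increase the power. -/
theorem sum_norm_sq_mul_leftSing_le (H : Matrix (Fin t) (Fin r) ℂ)
    (X : Matrix (Fin n) (Fin (min t r)) ℂ) :
    ∑ i, ∑ k, ‖(X * (leftSing H)ᴴ) i k‖ ^ 2 ≤ ∑ i, ∑ j, ‖X i j‖ ^ 2 := by
  have h : ((∑ i, ∑ k, ‖(X * (leftSing H)ᴴ) i k‖ ^ 2 : ℝ) : ℂ) =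
      ((∑ i, ∑ j, (if gains H j = 0 then 0 else 1) * ‖X i j‖ ^ 2 : ℝ) : ℂ) := by
    rw [sum_norm_sq_eq_trace, Matrix.conjTranspose_mul, Matrix.conjTranspose_conjTranspose,
      Matrix.mul_assoc, ← Matrix.mul_assoc (leftSing H)ᴴ, gram_leftSing, ← Matrix.mul_assoc]
    rw [Matrix.trace]
    push_cast
    refine Finset.sum_congr rfl fun i _ => ?_
    rw [Matrix.diag_apply, Matrix.mul_apply]
    refine Finset.sum_congr rfl fun j _ => ?_
    rw [Matrix.mul_diagonal, Matrix.conjTranspose_apply, RCLike.star_def, mul_right_comm,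
      Complex.mul_conj', mul_comm]
  rw [Complex.ofReal_inj.1 h]
  refine Finset.sum_le_sum fun i _ => Finset.sum_le_sum fun j _ => ?_
  split_ifs
  · rw [zero_mul]; positivity
  · rw [one_mul]

theorem realInner_eq_re_trace {a b : ℕ} (w z : Fin a → Fin b → ℂ) :
    realInner w z = ((Matrix.of w)ᴴ * Matrix.of z).trace.re := by
  simp only [Matrix.trace, Matrix.diag_apply, Matrix.mul_apply, Matrix.conjTranspose_apply,
    Matrix.of_apply, Complex.re_sum]
  rw [realInner, Finset.sum_comm]
  refine Finset.sum_congr rfl fun j _ => Finset.sum_congr rfl fun i _ => ?_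
  simp

/-- Right multiplication by a matrix, as a map of arrays. -/
def rightMul {a b c : ℕ} (V : Matrix (Fin b) (Fin c) ℂ) :
    (Fin a → Fin b → ℂ) →L[ℝ] (Fin a → Fin c → ℂ) :=
  LinearMap.toContinuousLinearMap
    { toFun := fun W => fun i j => (Matrix.of W * V) i j
      map_add' := fun W W' => by
        ext i j
        simp [Matrix.mul_apply, add_mul, Finset.sum_add_distrib]
      map_smul' := fun s W => by
        ext i j
        simp [Matrix.mul_apply, Finset.mul_sum, mul_assoc] }

/-- Projecting the noise to orthonormal vectors gives independent standard entries. -/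
theorem map_rightMul_stdNoise {a b c : ℕ} {V : Matrix (Fin b) (Fin c) ℂ} (hV : Vᴴ * V = 1) :
    (stdNoise a b).map (rightMul V) = stdNoise a c := by
  refine map_stdNoise _ (rightMul Vᴴ) (fun w z => ?_) (fun w => ?_)
  · rw [realInner_eq_re_trace, realInner_eq_re_trace]
    change ((Matrix.of w)ᴴ * (Matrix.of z * V)).trace.re =
      ((Matrix.of w * Vᴴ)ᴴ * Matrix.of z).trace.re
    rw [Matrix.conjTranspose_mul, Matrix.conjTranspose_conjTranspose, ← Matrix.mul_assoc,
      Matrix.trace_mul_comm, ← Matrix.mul_assoc]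
  · rw [realInner_eq_re_trace, realInner_eq_re_trace]
    change ((Matrix.of w * Vᴴ)ᴴ * (Matrix.of w * Vᴴ)).trace.re =
      ((Matrix.of w)ᴴ * Matrix.of w).trace.re
    rw [Matrix.conjTranspose_mul, Matrix.conjTranspose_conjTranspose, Matrix.mul_assoc,
      Matrix.trace_mul_comm, Matrix.mul_assoc, Matrix.mul_assoc, hV, Matrix.mul_one]

/-- Precoding along the left and projecting to the right singular vectors turns the matrix channel
into its eigen-channels. -/
theorem map_rightMul_mimoLaw (H : Matrix (Fin t) (Fin r) ℂ)
    (X : Matrix (Fin n) (Fin (min t r)) ℂ) :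
    (mimoLaw H (X * (leftSing H)ᴴ)).map (rightMul (rightSing H)) = eigenLaw (gains H) X := by
  rw [mimoLaw, eigenLaw, ← map_rightMul_stdNoise (rightSing_orthonormal H),
    Measure.map_map (ContinuousLinearMap.measurable _) (by fun_prop),
    Measure.map_map (by fun_prop) (ContinuousLinearMap.measurable _)]
  congr 1
  ext W i j
  have h1 : X * (leftSing H)ᴴ * H * rightSing H =
      X * Matrix.diagonal fun j => (√(gains H j) : ℂ) := by
    rw [Matrix.mul_assoc, Matrix.mul_assoc, conjTranspose_leftSing_mul]
  have h2 : (fun i k => (X * (leftSing H)ᴴ * H) i k + W i k) =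
      (fun i k => (X * (leftSing H)ᴴ * H) i k) + W := rfl
  simp only [Function.comp_apply]
  rw [h2, map_add]
  have h3 : rightMul (rightSing H) (fun i k => (X * (leftSing H)ᴴ * H) i k) i j =
      (√(gains H j) : ℂ) * X i j := by
    change (X * (leftSing H)ᴴ * H * rightSing H) i j = _
    rw [h1, Matrix.mul_diagonal, mul_comm]
  rw [Pi.add_apply, Pi.add_apply, h3]

/-- A code for the eigen-channels gives a code for the matrix channel. -/
theorem nonempty_code {P ε : ℝ} {H : Matrix (Fin t) (Fin r) ℂ} {M : ℕ}
    {p : Fin (min t r) → ℝ} (hn : 0 < n) (hp : ∑ j, p j = P)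
    (c : Fin M → Matrix (Fin n) (Fin (min t r)) ℂ) (hc : ∀ j, c j ∈ inputSet n p)
    {dec : (Fin n → Fin (min t r) → ℂ) → Fin M} (hdec : Measurable dec)
    (herr : ∀ j, (eigenLaw (gains H) (c j)).real {y | dec y ≠ j} ≤ ε) :
    Nonempty (Code n M t r P ε H) := by
  refine ⟨⟨fun j _ => c j * (leftSing H)ᴴ, fun j _ => ?_,
    fun Y _ => dec (rightMul (rightSing H) Y), fun _ =>
      hdec.comp (ContinuousLinearMap.measurable _), fun j => ?_⟩⟩
  · refine (sum_norm_sq_mul_leftSing_le H (c j)).trans_eq ?_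
    rw [Finset.sum_comm, ← hp, Finset.mul_sum]
    exact Finset.sum_congr rfl fun k _ => sum_norm_sq_of_mem_inputSet hn (hc j) k
  · have h := herr j
    rw [← map_rightMul_mimoLaw, map_measureReal_apply (ContinuousLinearMap.measurable _)] at h
    · exact h
    · exact (hdec (measurableSet_singleton j)).compl

end Reduction

/-! ### Rates -/

theorem log_div_le_maxRate {n t r M : ℕ} {P ε : ℝ} {H : Matrix (Fin t) (Fin r) ℂ} (hM : 1 ≤ M)
    (hcode : Nonempty (Code n M t r P ε H)) {x : ℝ} (hx : x ≤ Real.log M / n) :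
    (x : EReal) ≤ maxRate n P ε H := by
  refine (EReal.coe_le_coe_iff.2 hx).trans ?_
  unfold maxRate
  exact le_iSup_of_le M (le_iSup_of_le hM (le_iSup_of_le hcode le_rfl))

/-- The `κβ` bound for the matrix channel. -/
theorem log_kappa_div_le_maxRate {n t r : ℕ} {P ε τ γ : ℝ} {H : Matrix (Fin t) (Fin r) ℂ}
    {p : Fin (min t r) → ℝ} (hn : 0 < n) (hp0 : ∀ j, 0 ≤ p j) (hp : ∑ j, p j = P) (hτ : 0 < τ)
    (hε : ε < 1) (hγ : probH n p (gains H) γ = 1 - ε + τ) {κ : ℝ} (hκ0 : 0 < κ)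
    (hκ : κ ≤ kappa τ (inputSet n p) (eigenLaw (gains H)) (auxLaw n p (gains H))) :
    ((1 / n * Real.log (κ / probG n p (gains H) γ) : ℝ) : EReal) ≤ maxRate n P ε H := by
  have hg := gains_nonneg H
  have hb0 : 0 < probG n p (gains H) γ := probG_pos hn hp0 hg (by rw [hγ]; linarith)
  obtain ⟨M, c, dec, hM, hκM, hc, hdec, herr⟩ := exists_code (K := eigenLaw (gains H))
    (ν := auxLaw n p (gains H)) ⟨_, constInput_mem hn hp0⟩
    (A := fun X => {Y | γ ≤ infoDensity p (gains H) X Y})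
    (fun X => measurableSet_le measurable_const (measurable_llr _ _)) hτ hb0
    (fun X hX => (eigenLaw_real_infoDensity hn hp0 hg hX γ).trans hγ)
    (fun X hX => auxLaw_real_infoDensity hn hp0 hg hX γ)
  refine log_div_le_maxRate hM (nonempty_code hn hp c hc hdec herr) ?_
  rw [one_div_mul_eq_div]
  have hle : κ / probG n p (gains H) γ ≤ M := le_trans (by gcongr) hκM
  exact div_le_div_of_nonneg_right (Real.log_le_log (by positivity) hle) (Nat.cast_nonneg n)

end AmBC

end

theorem theorem1 {t r : ℕ} (Hsr : Matrix (Fin t) (Fin r) ℂ) (Hsg : Matrix (Fin t) (Fin 1) ℂ)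
    (Hgr : Matrix (Fin 1) (Fin r) ℂ) (A : ℂ) (P : ℝ) (hP : 0 < P)
    (H : ℤˣ → Matrix (Fin t) (Fin r) ℂ) (hH : H = AmBC.effChannel Hsr Hsg Hgr A)
    (hH0 : ∀ d, H d ≠ 0)
    (g : ℤˣ → Fin (min t r) → ℝ) (hg : ∀ d, g d = AmBC.gains (H d)) :
    (∀ d, ∃! l : ℝ, AmBC.IsWaterLevel (g d) P l) ∧
    ∀ (lam : ℤˣ → ℝ) (_ : ∀ d, AmBC.IsWaterLevel (g d) P (lam d))
      (p : ℤˣ → Fin (min t r) → ℝ) (_ : ∀ d, p d = AmBC.waterFill (g d) (lam d)),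
      -- the laws of the information density
      (∀ (d : ℤˣ) (n : ℕ), 0 < n → (AmBC.inputSet n (p d)).Nonempty ∧
        ∀ X ∈ AmBC.inputSet n (p d),
          AmBC.eigenLaw (g d) X ≪ AmBC.auxLaw n (p d) (g d) ∧
          (AmBC.auxLaw n (p d) (g d)).map (AmBC.infoDensity (p d) (g d) X) =
            (AmBC.stdNoise n (min t r)).map (AmBC.Gn (p d) (g d)) ∧
          (AmBC.eigenLaw (g d) X).map (AmBC.infoDensity (p d) (g d) X) =
            (AmBC.stdNoise n (min t r)).map (AmBC.Hn (p d) (g d))) ∧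
      -- the achievability bounds
      ∃ C₁ : ℝ, 0 < C₁ ∧ ∀ (n : ℕ) (ε τ : ℝ), 0 < n → 0 < τ → τ < ε → ε < 1 →
        (∀ d : ℤˣ,
          τ / C₁ ≤ AmBC.kappa τ (AmBC.inputSet n (p d)) (AmBC.eigenLaw (g d))
            (AmBC.auxLaw n (p d) (g d)) ∧
          (∃ γ : ℝ, AmBC.probH n (p d) (g d) γ = 1 - ε + τ) ∧
          ∀ γ : ℝ, AmBC.probH n (p d) (g d) γ = 1 - ε + τ →
            (∀ X ∈ AmBC.inputSet n (p d),
              AmBC.beta (1 - ε + τ) (AmBC.eigenLaw (g d) X) (AmBC.auxLaw n (p d) (g d)) =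
                AmBC.probG n (p d) (g d) γ) ∧
            0 < AmBC.probG n (p d) (g d) γ ∧
            ((1 / n * Real.log (AmBC.kappa τ (AmBC.inputSet n (p d)) (AmBC.eigenLaw (g d))
              (AmBC.auxLaw n (p d) (g d)) / AmBC.probG n (p d) (g d) γ) : ℝ) : EReal) ≤
                AmBC.maxRate n P ε (H d) ∧
            ((1 / n * Real.log (τ / C₁ / AmBC.probG n (p d) (g d) γ) : ℝ) : EReal) ≤
                AmBC.maxRate n P ε (H d)) ∧
        ∀ (tag : PMF ℤˣ) (γ : ℤˣ → ℝ),
          (∀ d, AmBC.probH n (p d) (g d) (γ d) = 1 - ε + τ) →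
          (((tag (-1)).toReal / n *
                Real.log (τ / C₁ / AmBC.probG n (p (-1)) (g (-1)) (γ (-1))) +
              (tag 1).toReal / n *
                Real.log (τ / C₁ / AmBC.probG n (p 1) (g 1) (γ 1)) : ℝ) : EReal) ≤
            AmBC.avgRate n P ε H tag := by
  subst hH
  have hg0 : ∀ d j, 0 ≤ g d j := fun d j => by rw [hg]; exact AmBC.gains_nonneg _ j
  have hgpos : ∀ d, ∃ j, 0 < g d j := fun d => by
    simp only [hg]; exact AmBC.exists_gains_pos (hH0 d)
  refine ⟨fun d => ?_, fun lam hlam p hp => ?_⟩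
  · obtain ⟨j, hj⟩ := hgpos d
    exact AmBC.existsUnique_isWaterLevel (hg0 d) hj hP
  have hp0 : ∀ d j, 0 ≤ p d j := fun d j => by
    rw [hp]; exact AmBC.waterPower_nonneg _ _
  have hpsum : ∀ d, ∑ j, p d j = P := fun d => by
    rw [hp]; exact hlam d
  have hpos : ∀ d, ∃ j, 0 < g d j * p d j := fun d => by
    rw [hp]; exact AmBC.exists_mul_waterFill_pos (hg0 d) hP (hlam d)
  refine ⟨fun d n hn => ⟨⟨_, AmBC.constInput_mem hn (hp0 d)⟩, fun X hX =>
    ⟨AmBC.eigenLaw_absolutelyContinuous (hp0 d) (hg0 d) X,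
      AmBC.map_infoDensity_auxLaw hn (hp0 d) (hg0 d) hX,
      AmBC.map_infoDensity_eigenLaw hn (hp0 d) (hg0 d) hX⟩⟩, ?_⟩
  set C : ℝ := max (AmBC.kappaConst (p 1) (g 1)) (AmBC.kappaConst (p (-1)) (g (-1))) with hC
  have hCle : ∀ d, AmBC.kappaConst (p d) (g d) ≤ C := fun d => by
    rcases Int.units_eq_one_or d with rfl | rfl
    exacts [le_max_left _ _, le_max_right _ _]
  have hC0 : 0 < C := (AmBC.kappaConst_pos (hp0 1) (hg0 1)).trans_le (hCle 1)
  -- one constant serves both tag symbols, since `τ / C` only decreases with `C`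
  refine ⟨C, hC0, fun n ε τ hn hτ hτε hε => ?_⟩
  have hκ : ∀ d, τ / C ≤ AmBC.kappa τ (AmBC.inputSet n (p d)) (AmBC.eigenLaw (g d))
      (AmBC.auxLaw n (p d) (g d)) := fun d =>
    (div_le_div_of_nonneg_left hτ.le (AmBC.kappaConst_pos (hp0 d) (hg0 d)) (hCle d)).trans
      (AmBC.div_le_kappa hn (hp0 d) (hg0 d) (by linarith))
  have hτC : 0 < τ / C := div_pos hτ hC0
  have hrate : ∀ (d : ℤˣ) (γ κ : ℝ), AmBC.probH n (p d) (g d) γ = 1 - ε + τ → 0 < κ →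
      κ ≤ AmBC.kappa τ (AmBC.inputSet n (p d)) (AmBC.eigenLaw (g d))
        (AmBC.auxLaw n (p d) (g d)) →
      ((1 / n * Real.log (κ / AmBC.probG n (p d) (g d) γ) : ℝ) : EReal) ≤
        AmBC.maxRate n P ε (AmBC.effChannel Hsr Hsg Hgr A d) := by
    intro d γ κ hγ hκ0 hκle
    rw [hg d] at hγ hκle ⊢
    exact AmBC.log_kappa_div_le_maxRate hn (hp0 d) (hpsum d) hτ hε hγ hκ0 hκle
  refine ⟨fun d => ⟨hκ d, ?_, fun γ hγ => ⟨fun X hX => ?_, ?_, ?_, ?_⟩⟩, fun tag γ hγ => ?_⟩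
  · obtain ⟨j, hj⟩ := hpos d
    exact AmBC.exists_probH_eq hn (hp0 d) (hg0 d) hj (by linarith) (by linarith)
  · exact AmBC.beta_eq_probG hn (hp0 d) (hg0 d) hX hγ
  · exact AmBC.probG_pos hn (hp0 d) (hg0 d) (by rw [hγ]; linarith)
  · exact hrate d γ _ hγ (hτC.trans_le (hκ d)) le_rfl
  · exact hrate d γ _ hγ hτC (hκ d)
  · have hterm : ∀ d : ℤˣ, (((tag d).toReal / n * Real.log (τ / C /
        AmBC.probG n (p d) (g d) (γ d)) : ℝ) : EReal) ≤ (((tag d).toReal : ℝ) : EReal) *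
          AmBC.maxRate n P ε (AmBC.effChannel Hsr Hsg Hgr A d) := by
      intro d
      rw [div_mul_eq_mul_div, mul_div_assoc, ← one_div_mul_eq_div, EReal.coe_mul]
      exact mul_le_mul_of_nonneg_left (hrate d (γ d) _ (hγ d) hτC (hκ d))
        (EReal.coe_nonneg.2 ENNReal.toReal_nonneg)
    rw [EReal.coe_add]
    exact add_le_add (hterm (-1)) (hterm 1)
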